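/- An $r$-graph is a finite hypergraph (without repeated edges) all of whose edges have exactly $r$ vertices; its chromatic number is the minimum number of colors in a vertex coloring with no monochromatic edge. Let $F_r$ be the $r$-graph on $2r-1$ vertices, consisting of an $(r-1)$-set $A$ and $r$ further vertices $b_1,\dots,b_r$, whose $r+1$ edges are $E_0=\{b_1,\dots,b_r\}$ and $E_i=A\cup\{b_i\}$ for $1\le i\le r$. An $r$-graph has independent neighborhoods if it contains no (not necessarily induced) copy of $F_r$. Let $m_k(F_r)$ be the minimum number of edges in an $r$-graph with independent neighborhoods and chromatic number greater than $k$. **Theorem.** Fix an integer $r\ge 3$. For all sufficiently large integers $k$ (depending on $r$), the minimum $m_k(F_r)$ exists and $$b\,k^{r+1/(r-1)} \;<\; m_k(F_r) \;<\; c\,k^{r+1/(r-1)}(\log k)^{1+r/(r-1)^2},$$ where $\log$ is the natural logarithm and $$b=\frac{1}{40\,r^2\,2^r},\qquad c=\left(r!\left(\frac{50\,r!\,(r+1)}{((r-1)!)^2}\right)^{1/r}\right)^{1/(r-3/2)}\left(\frac{10(r-1)}{r-3/2}\right)^{(r-1/2)/(r-3/2)}.$$ -/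

import Mathlib

open Filter
open scoped Nat

namespace Hypergraph

/-- `G` is an `r`-graph: a finite hypergraph all of whose edges have exactly `r` vertices. -/
def IsRGraph {α : Type*} (G : Hypergraph α) (r : ℕ) : Prop :=
  G.vertexSet.Finite ∧ ∀ e ∈ G.edgeSet, e.encard = r

/-- The vertex set of `G` can be coloured with the `n` colours `0, …, n - 1`
so that no edge is monochromatic. -/
def Colorable {α : Type*} (G : Hypergraph α) (n : ℕ) : Prop :=
  ∃ f : α → ℕ, (∀ v ∈ G.vertexSet, f v < n) ∧ ∀ e ∈ G.edgeSet, ¬ ∃ c, ∀ v ∈ e, f v = c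

/-- The chromatic number: the least number of colours in a proper colouring
(`⊤` if no finite number of colours suffices). -/
noncomputable def chromaticNumber {α : Type*} (G : Hypergraph α) : ℕ∞ :=
  ⨅ n ∈ {n : ℕ | G.Colorable n}, (n : ℕ∞)

/-- `G` contains a (not necessarily induced) copy of `H` as a subhypergraph. -/
def ContainsCopy {α β : Type*} (G : Hypergraph α) (H : Hypergraph β) : Prop :=
  ∃ f : β → α, Set.InjOn f H.vertexSet ∧ Set.MapsTo f H.vertexSet G.vertexSet ∧
    ∀ e ∈ H.edgeSet, f '' e ∈ G.edgeSet

/-- The numbers of edges of `H`-free `r`-graphs with chromatic number greater than `k`. -/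
def edgeCounts {β : Type*} (r k : ℕ) (H : Hypergraph β) : Set ℕ :=
  {m | ∃ (α : Type) (G : Hypergraph α), G.IsRGraph r ∧ ¬ G.ContainsCopy H ∧
    (k : ℕ∞) < G.chromaticNumber ∧ G.edgeSet.ncard = m}

/-- `m_k(H)`: the minimum number of edges of an `H`-free `r`-graph with chromatic number
greater than `k`. -/
noncomputable def minEdges {β : Type*} (r k : ℕ) (H : Hypergraph β) : ℕ :=
  sInf (edgeCounts r k H)

/-- The `r`-graph `F_r`. Its vertices are `r - 1` vertices forming a set `A` (left summand) and
`r` further vertices `b_i` (right summand); its `r + 1` edges are `E_0 = {b_1, …, b_r}` and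
`E_i = A ∪ {b_i}`. An `r`-graph contains no copy of `F_r` iff the neighbourhood of every
`(r - 1)`-set of its vertices is independent. -/
def starF (r : ℕ) : Hypergraph (Fin (r - 1) ⊕ Fin r) where
  vertexSet := Set.univ
  edgeSet := insert (Set.range Sum.inr)
    (Set.range fun i : Fin r => insert (Sum.inr i) (Set.range Sum.inl))
  subset_vertexSet_of_mem_edgeSet' := fun _ _ => Set.subset_univ _

end Hypergraph

/-- The constant `1 / (40 r² 2^r)` of the lower bound. -/
noncomputable def bI (r : ℕ) : ℝ := 1 / (40 * (r : ℝ) ^ 2 * 2 ^ r)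

/-- The constant of the upper bound:
`(r! (50 r! (r+1) / (r-1)!²)^{1/r})^{1/(r-3/2)} (10 (r-1) / (r-3/2))^{(r-1/2)/(r-3/2)}`. -/
noncomputable def cI (r : ℕ) : ℝ :=
  ((r ! : ℝ) * (50 * (r ! : ℝ) * ((r : ℝ) + 1) / ((r - 1)! : ℝ) ^ 2) ^ (1 / (r : ℝ)))
      ^ (1 / ((r : ℝ) - 3 / 2)) *
    (10 * ((r : ℝ) - 1) / ((r : ℝ) - 3 / 2)) ^ (((r : ℝ) - 1 / 2) / ((r : ℝ) - 3 / 2))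

/-! Put y = k^(1/(r-1)), so that y^(r-1) = k.

Lower bound. Let an r-graph with independent neighbourhoods have m ≤ b k^r y edges. Some colouring
with about k/2 colours has at most m / (k/2)^(r-1) monochromatic edges, up to rounding. One vertex
from each forms a set W of size O(ky), and once W gets fresh colours only the edges inside W matter.
A neighbourhood of an (r-1)-set contains no edge, so it may be a colour class: while some
neighbourhood has at least d ≈ y/(5r²) vertices in the rest of W, one colour is spent on it. This
takes at most |W|/d ≤ k/8 colours. In the remainder U all codegrees are below d, hence degrees are
at most |U|^(r-2) d = O(k^(r-2) y^(r-1)) = O(k^(r-1)), and the local lemma colours U with about k/4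
colours. `exists_coloring_of_indepNeighborhoods` combines the three colourings.

Upper bound. Take n = ks vertices, with s of order y (log k)^(r/(r-1)²), and make each r-set an edge
with probability p = 2 r! log k / s^(r-1). The local lemma avoids both the copies of F_r and the
s-sets without an edge; colour classes then have fewer than s vertices, so k colours do not suffice.
The avoidance event may be far too unlikely for a union bound with the edge count. Instead the
relative local lemma `prod_mul_pi_real_inter_avoid_le` shows that conditioning on avoidance raises
the probability of a given edge by a factor of at most 3/2, and a first moment argument inside that
event (`exists_mem_card_filter_le`) gives at most (3/2) p (ks)^r / r! = 3 k^r s log k edges. The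
result is `exists_indepNeighborhoods_of_le`; what remains is numerical. -/

/-! ### The local lemma for product measures, in relative form. -/

open MeasureTheory ProbabilityTheory in
/-- Under a product measure, events determined by disjoint sets of coordinates are independent. -/
theorem pi_real_inter_eq_mul {ι β : Type*} [Fintype ι] [Finite β] [MeasurableSpace β]
    [MeasurableSingletonClass β] (ν : Measure β) [IsProbabilityMeasure ν] {A B : Set (ι → β)}
    {S T : Finset ι} (hA : DependsOn (fun ω => ω ∈ A) (S : Set ι))
    (hB : DependsOn (fun ω => ω ∈ B) (T : Set ι)) (hST : Disjoint S T) :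
    (Measure.pi fun _ : ι => ν).real (A ∩ B) =
      (Measure.pi fun _ : ι => ν).real A * (Measure.pi fun _ : ι => ν).real B := by
  -- An event that depends only on the coordinates in `S` is the preimage of its own image under
  -- restriction to `S`.
  have key : ∀ {A : Set (ι → β)} {S : Finset ι}, DependsOn (fun ω => ω ∈ A) (S : Set ι) →
      A = (fun (ω : ι → β) (i : S) => ω i) ⁻¹' ((fun (ω : ι → β) (i : S) => ω i) '' A) := by
    intro A S hA
    refine (Set.subset_preimage_image _ _).antisymm ?_
    rintro ω ⟨ω', hω', h⟩
    have := hA (x := ω') (y := ω) fun i hi => congrFun h ⟨i, hi⟩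
    exact this.mp hω'
  have hind : iIndepFun (fun (i : ι) (ω : ι → β) => ω i) (Measure.pi fun _ : ι => ν) :=
    iIndepFun_pi (X := fun _ : ι => (id : β → β)) fun i => aemeasurable_id
  have h := hind.indepFun_finset S T hST fun i => measurable_pi_apply i
  have := h.measure_inter_preimage_eq_mul ((fun (ω : ι → β) (i : S) => ω i) '' A)
    ((fun (ω : ι → β) (i : T) => ω i) '' B) (Set.toFinite _).measurableSet
    (Set.toFinite _).measurableSet
  rw [← key hA, ← key hB] at this
  simp [Measure.real, this]

section LocalLemma

open MeasureTheory

variable {Ω I : Type*} [MeasurableSpace Ω] [DiscreteMeasurableSpace Ω] [DecidableEq I]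
  (μ : Measure Ω) [IsProbabilityMeasure μ] {A : I → Set Ω} {N : I → Finset I} {x : I → ℝ}
  {J : Finset I}

/-- If each event of `U \ T` is unlikely relative to the avoidance of fewer events, then
avoiding `U` costs at most the product of the `1 - x j`. -/
theorem prod_mul_real_avoid_le (hx1 : ∀ i ∈ J, x i ≤ 1) {n : ℕ}
    (h : ∀ T ⊆ J, T.card < n → ∀ i ∈ J, i ∉ T →
      μ.real (A i ∩ {ω | ∀ j ∈ T, ω ∉ A j}) ≤ x i * μ.real {ω | ∀ j ∈ T, ω ∉ A j})
    (T S : Finset I) (hT : T ⊆ J) (hS : S ⊆ J) (hTS : Disjoint T S) (hn : (T ∪ S).card ≤ n) :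
    (∏ j ∈ S, (1 - x j)) * μ.real {ω | ∀ j ∈ T, ω ∉ A j} ≤
      μ.real {ω | ∀ j ∈ T ∪ S, ω ∉ A j} := by
  induction S using Finset.induction_on with
  | empty => simp
  | insert i S hi ih =>
    have hiJ : i ∈ J := hS (Finset.mem_insert_self _ _)
    have hiT : i ∉ T := fun h => Finset.disjoint_left.mp hTS h (Finset.mem_insert_self _ _)
    have hSJ : S ⊆ J := (Finset.subset_insert _ _).trans hS
    have hiTS : i ∉ T ∪ S := by simp [hi, hiT]
    have hcard : (T ∪ S).card < n := by
      rw [Finset.union_insert, Finset.card_insert_of_notMem hiTS] at hn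
      omega
    have ih := ih hSJ (hTS.mono_right (Finset.subset_insert _ _)) hcard.le
    have h1 := h (T ∪ S) (Finset.union_subset hT hSJ) hcard i hiJ hiTS
    have h2 : μ.real {ω | ∀ j ∈ T ∪ insert i S, ω ∉ A j} =
        μ.real {ω | ∀ j ∈ T ∪ S, ω ∉ A j} - μ.real (A i ∩ {ω | ∀ j ∈ T ∪ S, ω ∉ A j}) := by
      rw [Set.inter_comm, eq_sub_iff_add_eq, add_comm,
        ← measureReal_inter_add_sdiff (μ := μ) (s := {ω | ∀ j ∈ T ∪ S, ω ∉ A j})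
          (t := A i) (MeasurableSet.of_discrete)]
      congr 2
      ext ω
      simp only [Finset.union_insert, Finset.mem_insert, forall_eq_or_imp, Set.mem_ofPred_eq,
        Set.mem_sdiff]
      tauto
    rw [Finset.prod_insert hi, h2, mul_assoc]
    have h3 := mul_le_mul_of_nonneg_left ih (sub_nonneg.mpr (hx1 i hiJ))
    linarith

/-- The inductive heart of the Lovász local lemma. -/
theorem real_inter_avoid_le (hx0 : ∀ i ∈ J, 0 ≤ x i) (hx1 : ∀ i ∈ J, x i ≤ 1)
    (hN : ∀ i ∈ J, N i ⊆ J)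
    (hind : ∀ i ∈ J, ∀ T ⊆ J, i ∉ T → Disjoint T (N i) →
      μ.real (A i ∩ {ω | ∀ j ∈ T, ω ∉ A j}) ≤ μ.real (A i) * μ.real {ω | ∀ j ∈ T, ω ∉ A j})
    (hx : ∀ i ∈ J, μ.real (A i) ≤ x i * ∏ j ∈ N i, (1 - x j)) :
    ∀ n : ℕ, ∀ T ⊆ J, T.card < n → ∀ i ∈ J, i ∉ T →
      μ.real (A i ∩ {ω | ∀ j ∈ T, ω ∉ A j}) ≤ x i * μ.real {ω | ∀ j ∈ T, ω ∉ A j} := by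
  intro n
  induction n with
  | zero => simp
  | succ n ih =>
    intro T hT hTn i hi hiT
    -- `T` splits into a part independent of `A i` and a part inside `N i`; the induction hypothesis
    -- bounds the cost of restoring the latter by the product over `T ∩ N i`.
    have hsub : T \ N i ⊆ J := Finset.sdiff_subset.trans hT
    have hunion : T \ N i ∪ T ∩ N i = T := Finset.sdiff_union_inter T (N i)
    have h1 := prod_mul_real_avoid_le μ hx1 ih (T \ N i) (T ∩ N i) hsub
      (Finset.inter_subset_left.trans hT)
      (Finset.disjoint_sdiff_inter T (N i)) (by rw [hunion]; omega)
    rw [hunion] at h1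
    have h2 := hind i hi (T \ N i) hsub (fun h => hiT (Finset.mem_sdiff.mp h).1)
      Finset.sdiff_disjoint
    have h3 : μ.real (A i ∩ {ω | ∀ j ∈ T, ω ∉ A j}) ≤
        μ.real (A i ∩ {ω | ∀ j ∈ T \ N i, ω ∉ A j}) :=
      measureReal_mono fun ω hω => ⟨hω.1, fun j hj => hω.2 j (Finset.mem_sdiff.mp hj).1⟩
    have h4 : ∏ j ∈ N i, (1 - x j) ≤ ∏ j ∈ T ∩ N i, (1 - x j) := by
      rw [← Finset.prod_sdiff (Finset.inter_subset_right (s₁ := T) (s₂ := N i))]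
      refine mul_le_of_le_one_left (Finset.prod_nonneg fun j hj => ?_)
        (Finset.prod_le_one (fun j hj => ?_) fun j hj => ?_)
      · exact sub_nonneg.mpr (hx1 j (hN i hi (Finset.mem_inter.mp hj).2))
      · exact sub_nonneg.mpr (hx1 j (hN i hi (Finset.mem_sdiff.mp hj).1))
      · have := hx0 j (hN i hi (Finset.mem_sdiff.mp hj).1)
        linarith
    calc _ ≤ μ.real (A i) * μ.real {ω | ∀ j ∈ T \ N i, ω ∉ A j} := h3.trans h2
      _ ≤ x i * (∏ j ∈ T ∩ N i, (1 - x j)) * μ.real {ω | ∀ j ∈ T \ N i, ω ∉ A j} := by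
        refine mul_le_mul_of_nonneg_right ((hx i hi).trans ?_) measureReal_nonneg
        exact mul_le_mul_of_nonneg_left h4 (hx0 i hi)
      _ ≤ _ := by
        rw [mul_assoc]
        exact mul_le_mul_of_nonneg_left h1 (hx0 i hi)

/-- The Lovász local lemma in relative form. -/
theorem prod_mul_real_avoid_le_of_local (hx0 : ∀ i ∈ J, 0 ≤ x i) (hx1 : ∀ i ∈ J, x i ≤ 1)
    (hN : ∀ i ∈ J, N i ⊆ J)
    (hind : ∀ i ∈ J, ∀ T ⊆ J, i ∉ T → Disjoint T (N i) →
      μ.real (A i ∩ {ω | ∀ j ∈ T, ω ∉ A j}) ≤ μ.real (A i) * μ.real {ω | ∀ j ∈ T, ω ∉ A j})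
    (hx : ∀ i ∈ J, μ.real (A i) ≤ x i * ∏ j ∈ N i, (1 - x j)) {S : Finset I} (hS : S ⊆ J) :
    (∏ j ∈ S, (1 - x j)) * μ.real {ω | ∀ j ∈ J \ S, ω ∉ A j} ≤ μ.real {ω | ∀ j ∈ J, ω ∉ A j} := by
  have := prod_mul_real_avoid_le μ hx1
    (real_inter_avoid_le μ hx0 hx1 hN hind hx (J.card + 1)) (J \ S) S
    Finset.sdiff_subset hS Finset.sdiff_disjoint
    (by rw [Finset.sdiff_union_of_subset hS]; omega)
  rwa [Finset.sdiff_union_of_subset hS] at this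

end LocalLemma

section VariableLocalLemma

open MeasureTheory

variable {ι β I : Type*} [Fintype ι] [DecidableEq ι] [Finite β] [MeasurableSpace β]
  [MeasurableSingletonClass β] (ν : Measure β) [IsProbabilityMeasure ν] [DecidableEq I]
  {A : I → Set (ι → β)} {N : I → Finset I} {x : I → ℝ} {J : Finset I} {vbl : I → Finset ι}

/-- The Lovász local lemma for events determined by few of many independent variables. -/
theorem prod_mul_pi_real_avoid_le (hx0 : ∀ i ∈ J, 0 ≤ x i) (hx1 : ∀ i ∈ J, x i ≤ 1)
    (hN : ∀ i ∈ J, N i ⊆ J) (hvbl : ∀ i ∈ J, DependsOn (fun ω => ω ∈ A i) (vbl i : Set ι))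
    (hdisj : ∀ i ∈ J, ∀ j ∈ J, j ∉ N i → Disjoint (vbl i) (vbl j))
    (hx : ∀ i ∈ J,
      (Measure.pi fun _ : ι => ν).real (A i) ≤ x i * ∏ j ∈ N i, (1 - x j))
    {S : Finset I} (hS : S ⊆ J) :
    (∏ j ∈ S, (1 - x j)) * (Measure.pi fun _ : ι => ν).real {ω | ∀ j ∈ J \ S, ω ∉ A j} ≤
      (Measure.pi fun _ : ι => ν).real {ω | ∀ j ∈ J, ω ∉ A j} := by
  refine prod_mul_real_avoid_le_of_local _ hx0 hx1 hN ?_ hx hS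
  intro i hi T hT hiT hTN
  refine (pi_real_inter_eq_mul ν (hvbl i hi) (T := T.biUnion vbl) ?_ ?_).le
  · intro ω ω' h
    simp only [Set.mem_ofPred_eq, eq_iff_iff]
    refine forall₂_congr fun j hj => not_congr (iff_of_eq ?_)
    exact hvbl j (hT hj) fun v hv => h v (by simpa using ⟨j, hj, hv⟩)
  · rw [Finset.disjoint_biUnion_right]
    exact fun j hj => hdisj i hi j (hT hj) (Finset.disjoint_left.mp hTN hj)

/-- The case S = J of the relative form: no event is left to avoid on the left, so the product
itself is a positive lower bound. -/
theorem pi_real_avoid_pos (hx0 : ∀ i ∈ J, 0 ≤ x i) (hx1 : ∀ i ∈ J, x i < 1)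
    (hN : ∀ i ∈ J, N i ⊆ J) (hvbl : ∀ i ∈ J, DependsOn (fun ω => ω ∈ A i) (vbl i : Set ι))
    (hdisj : ∀ i ∈ J, ∀ j ∈ J, j ∉ N i → Disjoint (vbl i) (vbl j))
    (hx : ∀ i ∈ J,
      (Measure.pi fun _ : ι => ν).real (A i) ≤ x i * ∏ j ∈ N i, (1 - x j)) :
    0 < (Measure.pi fun _ : ι => ν).real {ω | ∀ j ∈ J, ω ∉ A j} := by
  have := prod_mul_pi_real_avoid_le ν hx0 (fun i hi => (hx1 i hi).le) hN hvbl hdisj hx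
    Finset.Subset.rfl
  refine lt_of_lt_of_le ?_ this
  simp only [sdiff_self, Finset.bot_eq_empty, Finset.notMem_empty, IsEmpty.forall_iff,
    implies_true, Set.ofPred_true, probReal_univ, mul_one]
  exact Finset.prod_pos fun j hj => sub_pos.mpr (hx1 j hj)

/-- Conditioning on the avoidance of all bad events increases the probability of a further event
by a factor that involves only the bad events sharing a variable with it. -/
theorem prod_mul_pi_real_inter_avoid_le (hx0 : ∀ i ∈ J, 0 ≤ x i) (hx1 : ∀ i ∈ J, x i ≤ 1)
    (hN : ∀ i ∈ J, N i ⊆ J) (hvbl : ∀ i ∈ J, DependsOn (fun ω => ω ∈ A i) (vbl i : Set ι))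
    (hdisj : ∀ i ∈ J, ∀ j ∈ J, j ∉ N i → Disjoint (vbl i) (vbl j))
    (hx : ∀ i ∈ J,
      (Measure.pi fun _ : ι => ν).real (A i) ≤ x i * ∏ j ∈ N i, (1 - x j))
    {E : Set (ι → β)} {S : Finset I} {V : Finset ι} (hS : S ⊆ J)
    (hE : DependsOn (fun ω => ω ∈ E) (V : Set ι))
    (hES : ∀ j ∈ J, j ∉ S → Disjoint V (vbl j)) :
    (∏ j ∈ S, (1 - x j)) *
        (Measure.pi fun _ : ι => ν).real (E ∩ {ω | ∀ j ∈ J, ω ∉ A j}) ≤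
      (Measure.pi fun _ : ι => ν).real E *
        (Measure.pi fun _ : ι => ν).real {ω | ∀ j ∈ J, ω ∉ A j} := by
  have h1 := prod_mul_pi_real_avoid_le ν hx0 hx1 hN hvbl hdisj hx hS
  -- Only the events in `S` share variables with `E`. Dropping them gives independence; restoring
  -- them costs the product over `S`.
  have h2 : (Measure.pi fun _ : ι => ν).real (E ∩ {ω | ∀ j ∈ J, ω ∉ A j}) ≤
      (Measure.pi fun _ : ι => ν).real (E ∩ {ω | ∀ j ∈ J \ S, ω ∉ A j}) :=
    measureReal_mono fun ω hω => ⟨hω.1, fun j hj => hω.2 j (Finset.mem_sdiff.mp hj).1⟩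
  rw [pi_real_inter_eq_mul ν hE (B := {ω | ∀ j ∈ J \ S, ω ∉ A j})
    (T := (J \ S).biUnion vbl)] at h2
  · have h3 : 0 ≤ ∏ j ∈ S, (1 - x j) :=
      Finset.prod_nonneg fun j hj => sub_nonneg.mpr (hx1 j (hS hj))
    calc _ ≤ _ := mul_le_mul_of_nonneg_left h2 h3
      _ = (Measure.pi fun _ : ι => ν).real E * ((∏ j ∈ S, (1 - x j)) *
          (Measure.pi fun _ : ι => ν).real {ω | ∀ j ∈ J \ S, ω ∉ A j}) := by ring
      _ ≤ _ := mul_le_mul_of_nonneg_left h1 measureReal_nonneg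
  · intro ω ω' h
    simp only [Set.mem_ofPred_eq, eq_iff_iff]
    refine forall₂_congr fun j hj => not_congr (iff_of_eq ?_)
    exact hvbl j (Finset.mem_sdiff.mp hj).1 fun v hv => h v
      (Finset.mem_coe.mpr (Finset.mem_biUnion.mpr ⟨j, hj, hv⟩))
  · rw [Finset.disjoint_biUnion_right]
    exact fun j hj => hES j (Finset.mem_sdiff.mp hj).1 (Finset.mem_sdiff.mp hj).2

end VariableLocalLemma

/-! ### First moments and colourings of sparse hypergraphs. -/

open MeasureTheory in
open scoped Classical in
/-- The first moment method inside an event `D`. -/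
theorem exists_mem_card_filter_le {Ω ε : Type*} [Fintype Ω] [MeasurableSpace Ω]
    [MeasurableSingletonClass Ω] (μ : Measure Ω) [IsProbabilityMeasure μ] (E : Finset ε)
    (B : ε → Set Ω) {D : Set Ω} {c : ℝ} (hD : 0 < μ.real D)
    (h : ∑ e ∈ E, μ.real (B e ∩ D) ≤ c * μ.real D) :
    ∃ ω ∈ D, ((E.filter fun e => ω ∈ B e).card : ℝ) ≤ c := by
  by_contra! hcon
  have hsum : ∀ X : Set Ω, μ.real X = ∑ ω, if ω ∈ X then μ.real {ω} else 0 := by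
    intro X
    rw [← Finset.sum_filter, sum_measureReal_singleton]
    congr 1
    ext ω
    rw [Finset.mem_coe, Finset.mem_filter, and_iff_right (Finset.mem_univ ω)]
  have h1 : ∑ e ∈ E, μ.real (B e ∩ D) =
      ∑ ω, if ω ∈ D then ((E.filter fun e => ω ∈ B e).card : ℝ) * μ.real {ω} else 0 := by
    rw [Finset.sum_congr rfl fun e _ => hsum (B e ∩ D), Finset.sum_comm]
    refine Finset.sum_congr rfl fun ω _ => ?_
    by_cases hω : ω ∈ D
    · simp [hω, ← Finset.sum_filter]
    · simp [hω]
  have h2 : c * μ.real D = ∑ ω, if ω ∈ D then c * μ.real {ω} else 0 := by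
    rw [hsum D, Finset.mul_sum]
    exact Finset.sum_congr rfl fun ω _ => by split_ifs <;> simp
  -- A point of `D` with positive mass makes the comparison of the two sums strict.
  obtain ⟨ω₀, hω₀⟩ : ∃ ω, 0 < if ω ∈ D then μ.real {ω} else 0 := by
    by_contra! hle
    rw [hsum D] at hD
    exact absurd hD (not_lt.mpr (Finset.sum_nonpos fun ω _ => hle ω))
  refine absurd h (not_le.mpr ?_)
  rw [h1, h2]
  refine Finset.sum_lt_sum (fun ω _ => ?_) ⟨ω₀, Finset.mem_univ _, ?_⟩
  · split_ifs with hω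
    · exact mul_le_mul_of_nonneg_right (hcon ω hω).le measureReal_nonneg
    · rfl
  · split_ifs at hω₀ ⊢ with hω
    · exact mul_lt_mul_of_pos_right (hcon ω₀ hω) hω₀
    · exact absurd hω₀ (lt_irrefl _)

open MeasureTheory in
theorem pi_real_forall_eq {ι β : Type*} [Fintype ι] [MeasurableSpace β]
    (ν : Measure β) [IsProbabilityMeasure ν] (T : Finset ι) (b : β) :
    (Measure.pi fun _ : ι => ν).real {ω | ∀ i ∈ T, ω i = b} = ν.real {b} ^ T.card := by
  classical
  have : {ω : ι → β | ∀ i ∈ T, ω i = b} =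
      Set.univ.pi fun i => if i ∈ T then {b} else Set.univ := by
    ext ω
    simp only [Set.mem_ofPred_eq, Set.mem_pi, Set.mem_univ, true_imp_iff]
    refine forall_congr' fun i => ?_
    split_ifs with h <;> simp [h]
  rw [this, Measure.real, Measure.pi_pi, ENNReal.toReal_prod, ← Finset.prod_const,
    ← Finset.prod_subset (Finset.subset_univ T)]
  · exact Finset.prod_congr rfl fun i hi => by simp [hi, Measure.real]
  · intro i _ hi
    simp [hi]

-- Each of the q colours contributes q^(-(r+1)), and the union bound over colours cancels one
-- factor.
open MeasureTheory in
theorem uniform_real_monochromatic_le {V : Type*} [Fintype V] {q r : ℕ} [NeZero q]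
    {e : Finset V} (he : e.card = r + 1) :
    (Measure.pi fun _ : V => (PMF.uniformOfFintype (Fin q)).toMeasure).real
      {ω | ∃ c, ∀ v ∈ e, ω v = c} ≤ 1 / (q : ℝ) ^ r := by
  have : {ω : V → Fin q | ∃ c, ∀ v ∈ e, ω v = c} = ⋃ c, {ω | ∀ v ∈ e, ω v = c} := by
    ext ω
    simp
  rw [this]
  refine (measureReal_iUnion_fintype_le _).trans ?_
  have hq : (q : ℝ) ≠ 0 := Nat.cast_ne_zero.mpr (NeZero.ne q)
  have h1 : ∀ c : Fin q, (PMF.uniformOfFintype (Fin q)).toMeasure.real {c} = (q : ℝ)⁻¹ := by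
    intro c
    rw [Measure.real, PMF.toMeasure_apply_singleton _ _ (by measurability)]
    simp
  simp_rw [pi_real_forall_eq, h1, he]
  simp only [Finset.sum_const, Finset.card_univ, Fintype.card_fin, nsmul_eq_mul]
  rw [inv_pow, pow_succ, mul_inv, mul_left_comm, mul_inv_cancel₀ hq, mul_one, one_div]

theorem dependsOn_monochromatic {V β : Type*} (e : Finset V) :
    DependsOn (fun ω : V → β => ω ∈ {ω : V → β | ∃ c, ∀ v ∈ e, ω v = c}) (e : Set V) := by
  intro ω ω' h
  simp only [Set.mem_ofPred_eq, eq_iff_iff]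
  exact exists_congr fun c => forall₂_congr fun v hv => by rw [h v hv]

/-- Some colouring with `q` colours has at most the expected number of monochromatic edges. -/
theorem exists_coloring_card_monochromatic_le {V : Type*} [Fintype V] {q r : ℕ} (hq : 0 < q)
    (E : Finset (Finset V)) (hE : ∀ e ∈ E, e.card = r + 1) :
    ∃ (f : V → Fin q) (M : Finset (Finset V)), M ⊆ E ∧
      (∀ e ∈ E, (∃ c, ∀ v ∈ e, f v = c) → e ∈ M) ∧ (M.card : ℝ) * (q : ℝ) ^ r ≤ E.card := by
  classical
  have : NeZero q := ⟨hq.ne'⟩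
  obtain ⟨f, -, hf⟩ := exists_mem_card_filter_le
    (MeasureTheory.Measure.pi fun _ : V => (PMF.uniformOfFintype (Fin q)).toMeasure) E
    (fun e => {ω | ∃ c, ∀ v ∈ e, ω v = c}) (D := Set.univ) (c := E.card * (1 / (q : ℝ) ^ r))
    (by simp) (by
      simp only [Set.inter_univ, MeasureTheory.probReal_univ, mul_one]
      rw [← nsmul_eq_mul]
      exact Finset.sum_le_card_nsmul _ _ _ fun e he => uniform_real_monochromatic_le (hE e he))
  refine ⟨f, E.filter fun e => f ∈ {ω : V → Fin q | ∃ c, ∀ v ∈ e, ω v = c},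
    Finset.filter_subset _ _, fun e he hc => Finset.mem_filter.mpr ⟨he, hc⟩, ?_⟩
  have hq' : (0 : ℝ) < (q : ℝ) ^ r := by positivity
  rw [mul_one_div, le_div_iff₀ hq'] at hf
  refine le_of_eq_of_le ?_ hf
  congr!

/-- A uniform hypergraph of small maximum degree has a proper colouring with few colours. -/
theorem exists_coloring_of_degree_le {V : Type*} [Fintype V] [DecidableEq V] {q r D : ℕ}
    (hq : 0 < q) (E : Finset (Finset V)) (hE : ∀ e ∈ E, e.card = r + 1)
    (hD : ∀ v, (E.filter fun e => v ∈ e).card ≤ D) (h : 4 * (r + 1) * D ≤ q ^ r) :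
    ∃ f : V → Fin q, ∀ e ∈ E, ¬ ∃ c, ∀ v ∈ e, f v = c := by
  have : NeZero q := ⟨hq.ne'⟩
  rcases E.eq_empty_or_nonempty with rfl | ⟨e₀, he₀⟩
  · exact ⟨fun _ => 0, by simp⟩
  have hD1 : 1 ≤ D := by
    obtain ⟨v, hv⟩ := Finset.card_pos.mp (by rw [hE e₀ he₀]; omega : 0 < e₀.card)
    exact le_trans (Finset.card_pos.mpr ⟨e₀, by simp [he₀, hv]⟩) (hD v)
  have hqr : (4 : ℝ) * (r + 1) * D ≤ (q : ℝ) ^ r := by exact_mod_cast h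
  have hrD : (1 : ℝ) ≤ (r + 1) * D := by
    have : 1 ≤ (r + 1) * D := Nat.one_le_iff_ne_zero.mpr (by positivity)
    exact_mod_cast this
  have hqpos : (0 : ℝ) < (q : ℝ) ^ r := by positivity
  -- Twice the bound for the probability of a monochromatic edge: the product over the at most
  -- (r+1)D edges meeting a given one, itself included, is at least 1/2 by Bernoulli's inequality.
  set x : ℝ := 2 / (q : ℝ) ^ r with hxdef
  have hx0 : 0 ≤ x := by positivity
  have hxD : (r + 1) * D * x ≤ 1 / 2 := by
    rw [hxdef, mul_div_assoc', div_le_iff₀ hqpos]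
    linarith
  have hx1 : x ≤ 1 / 2 := by nlinarith
  have hpos := pi_real_avoid_pos (PMF.uniformOfFintype (Fin q)).toMeasure
    (A := fun e : Finset V => {ω : V → Fin q | ∃ c, ∀ v ∈ e, ω v = c})
    (N := fun e => E.filter fun e' => ¬ Disjoint e e') (x := fun _ => x) (J := E)
    (vbl := fun e => e) (fun _ _ => hx0) (fun _ _ => by linarith)
    (fun _ _ => Finset.filter_subset _ _) (fun e _ => dependsOn_monochromatic e)
    (fun e _ e' he' hn => by
      simp only [Finset.mem_filter, not_and, not_not] at hn
      exact hn he') (fun e he => by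
      refine (uniform_real_monochromatic_le (hE e he)).trans ?_
      rw [Finset.prod_const]
      have hcard : (E.filter fun e' => ¬ Disjoint e e').card ≤ (r + 1) * D := by
        rw [← hE e he]
        refine le_trans (Finset.card_le_card ?_)
          (Finset.card_biUnion_le_card_mul e (fun v => E.filter fun e' => v ∈ e') D
            fun v _ => hD v)
        intro e' he'
        simp only [Finset.mem_filter, Finset.not_disjoint_iff] at he'
        obtain ⟨he', v, hv, hv'⟩ := he'
        exact Finset.mem_biUnion.mpr ⟨v, hv, by simp [he', hv']⟩
      have hB := one_add_mul_le_pow (a := -x) (by linarith)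
        (E.filter fun e' => ¬ Disjoint e e').card
      have hcard' : ((E.filter fun e' => ¬ Disjoint e e').card : ℝ) ≤ (r + 1) * D := by
        exact_mod_cast hcard
      have h1 : 1 / 2 ≤ (1 - x) ^ (E.filter fun e' => ¬ Disjoint e e').card := by
        rw [← sub_eq_add_neg] at hB
        refine le_trans ?_ hB
        nlinarith
      calc 1 / (q : ℝ) ^ r = x * (1 / 2) := by rw [hxdef]; ring
        _ ≤ _ := mul_le_mul_of_nonneg_left h1 hx0)
  obtain ⟨f, hf⟩ : {ω : V → Fin q | ∀ e ∈ E, ω ∉ {ω : V → Fin q | ∃ c, ∀ v ∈ e, ω v = c}}.Nonempty := by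
    by_contra hne
    rw [Set.not_nonempty_iff_eq_empty] at hne
    rw [hne] at hpos
    simp at hpos
  exact ⟨f, fun e he => hf e he⟩

/-! ### Colouring hypergraphs with independent neighbourhoods. -/

/-- No edge lies inside the neighbourhood of a disjoint `(r - 1)`-set. -/
def IndepNeighborhoods {V : Type*} [DecidableEq V] (r : ℕ) (E : Finset (Finset V)) : Prop :=
  ∀ A B : Finset V, A.card = r - 1 → B ∈ E → Disjoint A B → ∃ b ∈ B, insert b A ∉ E

/-- Colouring large neighbourhoods one after the other leaves a set without any. -/
theorem exists_partial_coloring_codegree_lt {V : Type*} [DecidableEq V] {r d : ℕ} (hd : 0 < d)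
    {E : Finset (Finset V)} (hfree : IndepNeighborhoods r E) (hE : ∀ e ∈ E, e.Nonempty)
    (W : Finset V) :
    ∃ U ⊆ W, ∃ (j : ℕ) (f : V → ℕ), j * d ≤ W.card ∧ (∀ v ∈ W \ U, f v < j) ∧
      (∀ e ∈ E, e ⊆ W \ U → ¬ ∃ c, ∀ v ∈ e, f v = c) ∧
      ∀ A : Finset V, A.card = r - 1 →
        (U.filter fun v => v ∉ A ∧ insert v A ∈ E).card < d := by
  induction hn : W.card using Nat.strong_induction_on generalizing W with
  | _ n ih =>
  subst hn
  by_cases hW : ∀ A : Finset V, A.card = r - 1 →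
      (W.filter fun v => v ∉ A ∧ insert v A ∈ E).card < d
  · refine ⟨W, Finset.Subset.rfl, 0, fun _ => 0, by simp, by simp, ?_, hW⟩
    intro e he hsub
    rw [sdiff_self] at hsub
    exact absurd (Finset.subset_empty.mp hsub) (hE e he).ne_empty
  push Not at hW
  obtain ⟨A, hA, hdA⟩ := hW
  -- This large neighbourhood becomes the class of the new colour `j`. Recursion colours the rest
  -- with colours below `j`, so an edge of colour `j` would lie inside `B`, against independence.
  set B := W.filter fun v => v ∉ A ∧ insert v A ∈ E with hB
  have hBW : B ⊆ W := Finset.filter_subset _ _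
  have hcard : (W \ B).card + B.card = W.card := Finset.card_sdiff_add_card_eq_card hBW
  obtain ⟨U, hU, j, f, hj, hf, hmono, hco⟩ := ih (W \ B).card (by omega) (W \ B) rfl
  refine ⟨U, hU.trans Finset.sdiff_subset, j + 1, fun v => if v ∈ B then j else f v,
    by rw [add_mul]; omega, ?_, ?_, hco⟩
  · intro v hv
    by_cases hvB : v ∈ B
    · simp [hvB]
    · have := hf v (by simp_all)
      simp only [hvB, if_false]
      omega
  · rintro e he hsub ⟨c, hc⟩
    by_cases hex : ∃ v ∈ e, v ∈ B
    · obtain ⟨v, hve, hvB⟩ := hex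
      have hcj : c = j := by simpa [hvB] using (hc v hve).symm
      have heB : e ⊆ B := by
        intro u hu
        by_contra huB
        have h1 := hc u hu
        have h2 := hsub hu
        have h3 := hf u (by simp_all)
        simp only [huB, if_false] at h1
        omega
      obtain ⟨b, hb, hbE⟩ := hfree A e hA he (Finset.disjoint_right.mpr fun u hu =>
        (Finset.mem_filter.mp (heB hu)).2.1)
      exact hbE (Finset.mem_filter.mp (heB hb)).2.2
    · push Not at hex
      refine hmono e he (fun v hv => ?_) ⟨c, fun v hv => ?_⟩
      · have := hsub hv
        have := hex v hv
        simp_all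
      · simpa [hex v hv] using hc v hv

/-- Bounded codegrees bound the degrees. -/
theorem card_filter_mem_le_of_codegree_le {V : Type*} [DecidableEq V] {r d : ℕ}
    {E : Finset (Finset V)} (hE : ∀ e ∈ E, e.card = r + 3) {U : Finset V}
    (hco : ∀ A : Finset V, A.card = r + 2 →
      (U.filter fun v => v ∉ A ∧ insert v A ∈ E).card ≤ d) (v : V) :
    ((E.filter fun e => e ⊆ U).filter fun e => v ∈ e).card ≤ U.card ^ (r + 1) * d := by
  -- An edge through v is {u, v} ∪ T with |T| = r + 1: there are at most |U|^(r+1) sets T, and by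
  -- the codegree bound at most d vertices u for each.
  have hsub : ((E.filter fun e => e ⊆ U).filter fun e => v ∈ e) ⊆
      ((U.powersetCard (r + 1)).filter fun T => v ∉ T).biUnion fun T =>
        (U.filter fun u => u ∉ insert v T ∧ insert u (insert v T) ∈ E).image
          fun u => insert u (insert v T) := by
    intro e he
    simp only [Finset.mem_filter] at he
    obtain ⟨⟨heE, heU⟩, hv⟩ := he
    have h1 : (e.erase v).card = r + 2 := by rw [Finset.card_erase_of_mem hv, hE e heE]; rfl
    obtain ⟨u, hu⟩ := Finset.card_pos.mp (by rw [h1]; omega : 0 < (e.erase v).card)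
    have h2 : insert u (insert v ((e.erase v).erase u)) = e := by
      rw [Finset.insert_comm, Finset.insert_erase hu, Finset.insert_erase hv]
    simp only [Finset.mem_biUnion, Finset.mem_filter, Finset.mem_powersetCard, Finset.mem_image]
    refine ⟨(e.erase v).erase u, ⟨⟨?_, ?_⟩, ?_⟩, u, ⟨?_, ?_, ?_⟩, h2⟩
    · exact (Finset.erase_subset _ _).trans ((Finset.erase_subset _ _).trans heU)
    · rw [Finset.card_erase_of_mem hu, h1]; rfl
    · simp
    · exact heU (Finset.mem_of_mem_erase hu)
    · simp [Finset.ne_of_mem_erase hu]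
    · rwa [h2]
  refine (Finset.card_le_card hsub).trans ?_
  refine (Finset.card_biUnion_le_card_mul _ _ d fun T hT => ?_).trans ?_
  · simp only [Finset.mem_filter, Finset.mem_powersetCard] at hT
    exact Finset.card_image_le.trans
      (hco _ (by rw [Finset.card_insert_of_notMem hT.2, hT.1.2]))
  · refine Nat.mul_le_mul_right _ ((Finset.card_filter_le _ _).trans ?_)
    rw [Finset.card_powersetCard]
    exact Nat.choose_le_pow _ _

/-- Sufficient numerical conditions for an `r`-graph with independent neighbourhoods to be
`k`-colourable. -/
theorem exists_coloring_of_indepNeighborhoods {V : Type*} [Fintype V] [DecidableEq V]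
    {r k q₁ q₂ d : ℕ} (hq₁ : 0 < q₁) (hq₂ : 0 < q₂) (hd : 0 < d) {E : Finset (Finset V)}
    (hE : ∀ e ∈ E, e.card = r + 3) (hfree : IndepNeighborhoods (r + 3) E)
    (hk : ∀ w j : ℕ, (w : ℝ) * (q₁ : ℝ) ^ (r + 2) ≤ E.card → j * d ≤ w → q₁ + j + q₂ ≤ k)
    (hdeg : ∀ w : ℕ, (w : ℝ) * (q₁ : ℝ) ^ (r + 2) ≤ E.card →
      4 * (r + 3) * (w ^ (r + 1) * d) ≤ q₂ ^ (r + 2)) :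
    ∃ f : V → ℕ, (∀ v, f v < k) ∧ ∀ e ∈ E, ¬ ∃ c, ∀ v ∈ e, f v = c := by
  classical
  have hne : ∀ e ∈ E, e.Nonempty := fun e he =>
    Finset.card_pos.mp (by rw [hE e he]; omega)
  obtain ⟨f₁, M, -, hM, hf₁⟩ := exists_coloring_card_monochromatic_le hq₁ E hE
  rcases isEmpty_or_nonempty V with hV | hV
  · exact ⟨fun _ => 0, fun v => (hV.false v).elim,
      fun e he => (hV.false (hne e he).choose).elim⟩
  -- `W` meets every edge that is monochromatic under `f₁`, so edges disjoint from `W` are already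
  -- properly coloured.
  choose! g hg using hne
  set W := M.image g with hW
  have hWc : (W.card : ℝ) * (q₁ : ℝ) ^ (r + 2) ≤ E.card := by
    refine le_trans (mul_le_mul_of_nonneg_right ?_ (by positivity)) hf₁
    exact_mod_cast Finset.card_image_le
  have hmono₁ : ∀ e ∈ E, Disjoint e W → ¬ ∃ c, ∀ v ∈ e, f₁ v = c := by
    intro e he hdis hc
    exact Finset.disjoint_left.mp hdis (hg e he)
      (Finset.mem_image_of_mem g (hM e he hc))
  obtain ⟨U, hU, j, f₂, hj, hf₂, hmono₂, hco⟩ :=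
    exists_partial_coloring_codegree_lt hd hfree (fun e he => ⟨g e, hg e he⟩) W
  have hUc : U.card ≤ W.card := Finset.card_le_card hU
  obtain ⟨f₃, hf₃⟩ := exists_coloring_of_degree_le (r := r + 2) (D := W.card ^ (r + 1) * d) hq₂
    (E.filter fun e => e ⊆ U)
    (fun e he => hE e (Finset.mem_filter.mp he).1)
    (fun v => (card_filter_mem_le_of_codegree_le hE (fun A hA => (hco A hA).le) v).trans
      (Nat.mul_le_mul_right _ (Nat.pow_le_pow_left hUc _)))
    (hdeg W.card hWc)
  have hk' := hk W.card j hWc hj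
  -- The complement of `W`, the set `W \ U` and `U` use the disjoint palettes [0, q₁), [q₁, q₁ + j)
  -- and [q₁ + j, q₁ + j + q₂), so a monochromatic edge lies within one of the three.
  refine ⟨fun v => if v ∈ U then q₁ + j + f₃ v else if v ∈ W then q₁ + f₂ v else f₁ v, ?_, ?_⟩
  · intro v
    have h1 := (f₁ v).isLt
    have h3 := (f₃ v).isLt
    by_cases hvU : v ∈ U
    · simp only [hvU, if_true]; omega
    · by_cases hvW : v ∈ W
      · have h2 := hf₂ v (by simp [hvU, hvW])
        simp only [hvU, hvW, if_true, if_false]; omega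
      · simp only [hvU, hvW, if_false]; omega
  · rintro e he ⟨c, hc⟩
    rcases lt_or_ge c q₁ with hlt | hge
    · have hnW : ∀ v ∈ e, v ∉ W := by
        intro v hv hvW
        have := hc v hv
        simp only [hvW, if_true] at this
        split_ifs at this <;> omega
      refine hmono₁ e he (Finset.disjoint_left.mpr hnW) ⟨f₁ (g e), fun v hv => Fin.ext ?_⟩
      have h : ∀ v ∈ e, (f₁ v : ℕ) = c := fun v hv => by
        have := hc v hv
        simpa [hnW v hv, show v ∉ U from fun h => hnW v hv (hU h)] using this
      rw [h v hv, h _ (hg e he)]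
    · have hinW : ∀ v ∈ e, v ∈ W := by
        intro v hv
        by_contra hvW
        have := hc v hv
        have h1 := (f₁ v).isLt
        simp only [hvW, show v ∉ U from fun h => hvW (hU h), if_false] at this
        omega
      rcases lt_or_ge c (q₁ + j) with hlt | hge'
      · have hnU : ∀ v ∈ e, v ∉ U := by
          intro v hv hvU
          have := hc v hv
          simp only [hvU, if_true] at this
          omega
        refine hmono₂ e he (fun v hv => by simp [hinW v hv, hnU v hv]) ⟨c - q₁, fun v hv => ?_⟩
        have := hc v hv
        simp only [hnU v hv, hinW v hv, if_true, if_false] at this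
        omega
      · have hinU : ∀ v ∈ e, v ∈ U := by
          intro v hv
          by_contra hvU
          have := hc v hv
          have h2 := hf₂ v (by simp [hvU, hinW v hv])
          simp only [hvU, hinW v hv, if_true, if_false] at this
          omega
        refine hf₃ e (Finset.mem_filter.mpr ⟨he, hinU⟩) ⟨f₃ (g e), fun v hv => Fin.ext ?_⟩
        have h : ∀ v ∈ e, q₁ + j + (f₃ v : ℕ) = c := fun v hv => by
          have := hc v hv
          simpa [hinU v hv] using this
        have h1 := h v hv
        have h2 := h _ (hg e he)
        omega

/-! ### Passage to finite sets of edges. -/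

namespace Hypergraph

theorem Colorable.mono {α : Type*} {G : Hypergraph α} {m n : ℕ} (h : G.Colorable m)
    (hmn : m ≤ n) : G.Colorable n := by
  obtain ⟨f, hf, hf'⟩ := h
  exact ⟨f, fun v hv => (hf v hv).trans_le hmn, hf'⟩

theorem lt_chromaticNumber_iff {α : Type*} {G : Hypergraph α} {k : ℕ} :
    (k : ℕ∞) < G.chromaticNumber ↔ ¬ G.Colorable k := by
  constructor
  · intro h hk
    exact absurd h (not_lt.mpr (iInf₂_le k hk))
  · intro h
    have : ((k + 1 : ℕ) : ℕ∞) ≤ G.chromaticNumber := by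
      refine le_iInf₂ fun n hn => ?_
      have : ¬ n ≤ k := fun hnk => h (Colorable.mono hn hnk)
      exact_mod_cast (by omega : k + 1 ≤ n)
    exact lt_of_lt_of_le (by exact_mod_cast Nat.lt_succ_self k) this

/-- The edges of `G` as finite sets of vertices. -/
theorem exists_finset_edges {α : Type*} (G : Hypergraph α) {r : ℕ}
    (hG : G.IsRGraph (r + 1)) (hfree : ¬ G.ContainsCopy (starF (r + 1))) [Fintype G.vertexSet]
    [DecidableEq G.vertexSet] :
    ∃ E : Finset (Finset G.vertexSet), (∀ e ∈ E, e.card = r + 1) ∧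
      IndepNeighborhoods (r + 1) E ∧ E.card ≤ G.edgeSet.ncard ∧
      ∀ e ∈ G.edgeSet, ∃ e' ∈ E, Subtype.val '' (e' : Set G.vertexSet) = e := by
  classical
  set E := (Finset.univ : Finset (Finset G.vertexSet)).filter
    fun e : Finset G.vertexSet => Subtype.val '' (e : Set G.vertexSet) ∈ G.edgeSet with hE
  have hmem : ∀ e : Finset G.vertexSet, e ∈ E ↔ Subtype.val '' (e : Set G.vertexSet) ∈ G.edgeSet := by simp [hE]
  have hcard : ∀ e ∈ E, e.card = r + 1 := by
    intro e he
    have h := hG.2 _ ((hmem e).mp he)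
    rw [Subtype.val_injective.encard_image, Set.encard_coe_eq_coe_finsetCard] at h
    exact_mod_cast h
  have hfin : G.edgeSet.Finite :=
    hG.1.finite_subsets.subset fun e he => G.subset_vertexSet_of_mem_edgeSet' he
  refine ⟨E, hcard, ?_, ?_, ?_⟩
  · intro A B hA hB hAB
    by_contra! hcon
    refine hfree ?_
    have hA' : A.card = r := hA
    let a := (A.equivFinOfCardEq hA').symm
    let b := (B.equivFinOfCardEq (hcard B hB)).symm
    have ha : Set.range (fun i => ((a i : G.vertexSet) : α)) =
        Subtype.val '' (A : Set G.vertexSet) := by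
      ext z
      constructor
      · rintro ⟨i, rfl⟩
        exact ⟨a i, (a i).2, rfl⟩
      · rintro ⟨x, hx, rfl⟩
        exact ⟨a.symm ⟨x, hx⟩, by simp⟩
    have hb : Set.range (fun i => ((b i : G.vertexSet) : α)) =
        Subtype.val '' (B : Set G.vertexSet) := by
      ext z
      constructor
      · rintro ⟨i, rfl⟩
        exact ⟨b i, (b i).2, rfl⟩
      · rintro ⟨x, hx, rfl⟩
        exact ⟨b.symm ⟨x, hx⟩, by simp⟩
    refine ⟨Sum.elim (fun i => ((a i : G.vertexSet) : α)) fun i => ((b i : G.vertexSet) : α),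
      ?_, ?_, ?_⟩
    · refine (Function.Injective.sumElim ?_ ?_ ?_).injOn
      · exact Subtype.val_injective.comp (Subtype.val_injective.comp a.injective)
      · exact Subtype.val_injective.comp (Subtype.val_injective.comp b.injective)
      · intro i j h
        have h' : (a i : G.vertexSet) = b j := Subtype.ext h
        exact Finset.disjoint_left.mp hAB (a i).2 (h' ▸ (b j).2)
    · rintro (i | i) -
      · exact (a i : G.vertexSet).2
      · exact (b i : G.vertexSet).2
    · rintro e (rfl | ⟨i, rfl⟩)
      · rw [← Set.range_comp, Sum.elim_comp_inr, hb]
        exact (hmem B).mp hB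
      · have := (hmem _).mp (hcon (b i) (b i).2)
        rw [Finset.coe_insert, Set.image_insert_eq, ← ha] at this
        rw [Set.image_insert_eq, ← Set.range_comp, Sum.elim_comp_inl]
        exact this
  · rw [← Set.ncard_coe_finset]
    exact Set.ncard_le_ncard_of_injOn (fun e => Subtype.val '' (e : Set G.vertexSet))
      (fun e he => (hmem e).mp he)
      (fun e _ e' _ h => Finset.coe_injective (Subtype.val_injective.image_injective h)) hfin
  · intro e he
    have hsub := G.subset_vertexSet_of_mem_edgeSet' he
    refine ⟨Finset.univ.filter fun v => (v : α) ∈ e, ?_, ?_⟩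
    · rw [hmem]
      convert he
      ext z
      simpa using fun hz => hsub hz
    · ext z
      simpa using fun hz => hsub hz

/-- Sufficient numerical conditions for an `r`-graph with independent neighbourhoods to be
`k`-colourable. -/
theorem colorable_of_not_containsCopy_starF {α : Type*} (G : Hypergraph α)
    {r k q₁ q₂ d : ℕ} (hq₁ : 0 < q₁) (hq₂ : 0 < q₂) (hd : 0 < d) (hG : G.IsRGraph (r + 3))
    (hfree : ¬ G.ContainsCopy (starF (r + 3)))
    (hk : ∀ w j : ℕ, (w : ℝ) * (q₁ : ℝ) ^ (r + 2) ≤ G.edgeSet.ncard → j * d ≤ w →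
      q₁ + j + q₂ ≤ k)
    (hdeg : ∀ w : ℕ, (w : ℝ) * (q₁ : ℝ) ^ (r + 2) ≤ G.edgeSet.ncard →
      4 * (r + 3) * (w ^ (r + 1) * d) ≤ q₂ ^ (r + 2)) : G.Colorable k := by
  classical
  have := hG.1.fintype
  obtain ⟨E, hE, hEfree, hEcard, hEedge⟩ := exists_finset_edges G (r := r + 2) hG hfree
  have hEcard' : (E.card : ℝ) ≤ G.edgeSet.ncard := by exact_mod_cast hEcard
  obtain ⟨f, hf, hmono⟩ := exists_coloring_of_indepNeighborhoods hq₁ hq₂ hd hE hEfree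
    (fun w j hw => hk w j (hw.trans hEcard')) (fun w hw => hdeg w (hw.trans hEcard'))
  refine ⟨fun v => if hv : v ∈ G.vertexSet then f ⟨v, hv⟩ else 0, ?_, ?_⟩
  · intro v hv
    simpa [hv] using hf ⟨v, hv⟩
  · rintro e he ⟨c, hc⟩
    obtain ⟨e', he', rfl⟩ := hEedge e he
    refine hmono e' he' ⟨c, fun v hv => ?_⟩
    have := hc v ⟨v, hv, rfl⟩
    simpa using this

end Hypergraph

/-! ### The lower bound. -/

/-- For large `k`, an `r`-graph with independent neighbourhoods and few edges is
`k`-colourable. -/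
theorem eventually_bI_mul_lt_of_mem_edgeCounts (r : ℕ) (hr : 3 ≤ r) :
    ∀ᶠ k : ℕ in atTop, ∀ m ∈ Hypergraph.edgeCounts r k (Hypergraph.starF r),
      bI r * (k : ℝ) ^ ((r : ℝ) + 1 / ((r : ℝ) - 1)) < m := by
  obtain ⟨t, rfl⟩ : ∃ t, r = t + 3 := ⟨r - 3, by omega⟩
  -- With y ≥ 180, rounding up in `d` costs 1 ≤ y/180 = y/36 - y/45.
  have hlarge : ∀ᶠ k : ℕ in atTop, (180 : ℝ) ≤ (k : ℝ) ^ (1 / ((t : ℝ) + 2)) :=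
    ((tendsto_rpow_atTop (by positivity)).comp tendsto_natCast_atTop_atTop).eventually_ge_atTop
      180
  filter_upwards [hlarge, eventually_ge_atTop (2 * (t + 2)), eventually_ge_atTop 8]
    with k hy hk1 hk8 m hm
  obtain ⟨α, G, hG, hfree, hχ, rfl⟩ := hm
  rw [Hypergraph.lt_chromaticNumber_iff] at hχ
  by_contra! hle
  refine hχ ?_
  set y : ℝ := (k : ℝ) ^ (1 / ((t : ℝ) + 2)) with hydef
  have hk0 : (0 : ℝ) < k := by exact_mod_cast (by omega : 0 < k)
  have hypow : y ^ (t + 2) = k := by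
    rw [hydef, ← Real.rpow_natCast, ← Real.rpow_mul hk0.le]
    push_cast
    rw [one_div, inv_mul_cancel₀ (by positivity), Real.rpow_one]
  have hexp : (k : ℝ) ^ (((t + 3 : ℕ) : ℝ) + 1 / (((t + 3 : ℕ) : ℝ) - 1)) =
      (k : ℝ) ^ (t + 3) * y := by
    rw [Real.rpow_add hk0, Real.rpow_natCast, hydef]
    push_cast
    ring_nf
  have hb : bI (t + 3) = 1 / (40 * ((t : ℝ) + 3) ^ 2 * 2 ^ (t + 3)) := by
    simp [bI]
  rw [hexp, hb] at hle
  set m : ℝ := (G.edgeSet.ncard : ℝ) with hmdef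
  have ht0 : (0 : ℝ) ≤ t := Nat.cast_nonneg t
  -- Rounding k/2 down costs a factor (1 - 1/k)^(t+2), at least 1/2 because k ≥ 2(t+2); hence the
  -- exponent t + 3 of 2.
  have hq1 : (k : ℝ) ^ (t + 2) / 2 ^ (t + 3) ≤ ((k / 2 : ℕ) : ℝ) ^ (t + 2) := by
    have h1 : (k : ℝ) ≤ 2 * ((k / 2 : ℕ) : ℝ) + 1 := by
      exact_mod_cast (by omega : k ≤ 2 * (k / 2) + 1)
    have h2 : 1 + -(1 / (k : ℝ)) ≤ 2 * ((k / 2 : ℕ) : ℝ) / k := by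
      rw [le_div_iff₀ hk0, add_mul, neg_mul, one_div, inv_mul_cancel₀ hk0.ne']
      linarith
    have h3 : 1 / (k : ℝ) ≤ 1 := by
      rw [div_le_one hk0]; exact_mod_cast (by omega : 1 ≤ k)
    have h4 := one_add_mul_le_pow (a := -(1 / (k : ℝ))) (by linarith) (t + 2)
    have h5 := pow_le_pow_left₀ (by linarith) h2 (t + 2)
    have h6 : ((t + 2 : ℕ) : ℝ) * (1 / k) ≤ 1 / 2 := by
      rw [mul_one_div, div_le_iff₀ hk0]
      have : ((2 * (t + 2) : ℕ) : ℝ) ≤ k := by exact_mod_cast hk1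
      push_cast at this ⊢
      linarith
    have h7 : (1 : ℝ) / 2 ≤ (2 * ((k / 2 : ℕ) : ℝ) / k) ^ (t + 2) := by linarith
    rw [div_pow, le_div_iff₀ (by positivity), mul_pow] at h7
    rw [div_le_iff₀ (by positivity), pow_succ (2 : ℝ) (t + 2)]
    linarith
  have hw : ∀ w : ℕ, (w : ℝ) * ((k / 2 : ℕ) : ℝ) ^ (t + 2) ≤ m →
      (w : ℝ) ≤ k * y / (40 * ((t : ℝ) + 3) ^ 2) := by
    intro w hw
    have h1 : (w : ℝ) * ((k : ℝ) ^ (t + 2) / 2 ^ (t + 3)) ≤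
        (k * y / (40 * ((t : ℝ) + 3) ^ 2)) * ((k : ℝ) ^ (t + 2) / 2 ^ (t + 3)) := by
      calc _ ≤ (w : ℝ) * ((k / 2 : ℕ) : ℝ) ^ (t + 2) :=
            mul_le_mul_of_nonneg_left hq1 (Nat.cast_nonneg w)
        _ ≤ _ := hw.trans hle
        _ = _ := by field_simp; ring
    exact le_of_mul_le_mul_right h1 (by positivity)
  -- The threshold that turns the bound on |W| into |W|/d ≤ k/8; the palettes then have total size
  -- at most k/2 + k/8 + k/4 < k.
  set d : ℕ := ⌈y / (5 * ((t : ℝ) + 3) ^ 2)⌉₊ with hd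
  have hd1 : y / (5 * ((t : ℝ) + 3) ^ 2) ≤ d := Nat.le_ceil _
  have hd0 : 0 < d := Nat.ceil_pos.mpr (by positivity)
  have hd2 : (d : ℝ) ≤ y / 36 := by
    have h1 : (d : ℝ) < y / (5 * ((t : ℝ) + 3) ^ 2) + 1 := Nat.ceil_lt_add_one (by positivity)
    have h2 : y / (5 * ((t : ℝ) + 3) ^ 2) ≤ y / 45 := by
      refine div_le_div_of_nonneg_left (by positivity) (by norm_num) ?_
      nlinarith
    linarith
  refine G.colorable_of_not_containsCopy_starF (q₁ := k / 2) (q₂ := k / 4) (d := d)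
    (by omega) (by omega) hd0 hG hfree ?_ ?_
  · intro w j hwm hj
    have h1 := hw w hwm
    have h2 : (j : ℝ) * d ≤ w := by exact_mod_cast hj
    have h3 : (j : ℝ) * d ≤ k / 8 * d := by
      have : (k : ℝ) / 8 * (y / (5 * ((t : ℝ) + 3) ^ 2)) ≤ k / 8 * d :=
        mul_le_mul_of_nonneg_left hd1 (by positivity)
      have h4 : k * y / (40 * ((t : ℝ) + 3) ^ 2) =
        (k : ℝ) / 8 * (y / (5 * ((t : ℝ) + 3) ^ 2)) := by field_simp; norm_num
      linarith
    have h4 : (j : ℝ) ≤ k / 8 := le_of_mul_le_mul_right h3 (by exact_mod_cast hd0)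
    have h5 : 8 * j ≤ k := by
      have : (8 : ℝ) * j ≤ k := by linarith
      exact_mod_cast this
    omega
  · intro w hwm
    have h1 := hw w hwm
    have hq2 : (k : ℝ) / 8 ≤ ((k / 4 : ℕ) : ℝ) := by
      have : (k : ℝ) ≤ 8 * ((k / 4 : ℕ) : ℝ) := by exact_mod_cast (by omega : k ≤ 8 * (k / 4))
      linarith
    have hconst : ((t : ℝ) + 3) * 8 ^ (t + 2) ≤ 9 * (40 * ((t : ℝ) + 3) ^ 2) ^ (t + 1) := by
      have h2 : (t : ℝ) + 3 ≤ (5 * ((t : ℝ) + 3) ^ 2) ^ (t + 1) := by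
        refine le_trans ?_ (le_self_pow₀ ?_ (Nat.succ_ne_zero t)) <;> nlinarith
      have h3 : (40 * ((t : ℝ) + 3) ^ 2) ^ (t + 1) =
          8 ^ (t + 1) * (5 * ((t : ℝ) + 3) ^ 2) ^ (t + 1) := by
        rw [← mul_pow]; ring
      have h4 : (0 : ℝ) < 8 ^ (t + 1) := by positivity
      rw [h3, pow_succ (8 : ℝ) (t + 1)]
      nlinarith
    -- Here the exponent 1/(r-1) balances: w^(t+1) d has order k^(t+1) y^(t+2) = k^(t+2), the order
    -- of q₂^(t+2).
    have key : (4 : ℝ) * (t + 3) * ((w : ℝ) ^ (t + 1) * d) ≤ ((k / 4 : ℕ) : ℝ) ^ (t + 2) := by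
      calc (4 : ℝ) * (t + 3) * ((w : ℝ) ^ (t + 1) * d)
          ≤ 4 * (t + 3) * ((k * y / (40 * ((t : ℝ) + 3) ^ 2)) ^ (t + 1) * (y / 36)) := by
            gcongr
        _ = (t + 3) / (9 * (40 * ((t : ℝ) + 3) ^ 2) ^ (t + 1)) * (k ^ (t + 1) * y ^ (t + 2)) := by
            rw [div_pow, mul_pow]
            field_simp
            ring
        _ = (t + 3) / (9 * (40 * ((t : ℝ) + 3) ^ 2) ^ (t + 1)) * k ^ (t + 2) := by
            rw [hypow]; ring
        _ ≤ 1 / 8 ^ (t + 2) * k ^ (t + 2) := by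
            refine mul_le_mul_of_nonneg_right ?_ (by positivity)
            rw [div_le_div_iff₀ (by positivity) (by positivity)]
            linarith
        _ = (k / 8 : ℝ) ^ (t + 2) := by rw [div_pow]; ring
        _ ≤ _ := pow_le_pow_left₀ (by positivity) hq2 _
    exact_mod_cast key

/-! ### The random construction. -/

section RandomHypergraph

variable {V : Type*} [Fintype V] [DecidableEq V]

/-- The edges of the copy of `F_r` spanned by the disjoint sets `A` and `B`. -/
def copyEdges (AB : Finset V × Finset V) : Finset (Finset V) :=
  insert AB.2 (AB.2.image fun b => insert b AB.1)

variable (V) in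
/-- The pairs of disjoint sets of sizes `a` and `a + 1`. -/
def copyPairs (a : ℕ) : Finset (Finset V × Finset V) :=
  Finset.univ.filter fun AB => AB.1.card = a ∧ AB.2.card = a + 1 ∧ Disjoint AB.1 AB.2

theorem card_of_mem_copyEdges {a : ℕ} {AB : Finset V × Finset V} (h : AB ∈ copyPairs V a)
    {e : Finset V} (he : e ∈ copyEdges AB) : e.card = a + 1 := by
  simp only [copyPairs, Finset.mem_filter, Finset.mem_univ, true_and] at h
  simp only [copyEdges, Finset.mem_insert, Finset.mem_image] at he
  obtain rfl | ⟨b, hb, rfl⟩ := he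
  · exact h.2.1
  · rw [Finset.card_insert_of_notMem (Finset.disjoint_right.mp h.2.2 hb), h.1]

/-- Nonemptiness of A separates the edge B from the edges A ∪ {b}, since A is disjoint from B. -/
theorem card_copyEdges {a : ℕ} (ha : 0 < a) {AB : Finset V × Finset V}
    (h : AB ∈ copyPairs V a) : (copyEdges AB).card = a + 2 := by
  simp only [copyPairs, Finset.mem_filter, Finset.mem_univ, true_and] at h
  rw [copyEdges, Finset.card_insert_of_notMem, Finset.card_image_of_injOn, h.2.1]
  · intro b hb c hc hbc
    have hb' : b ∈ insert c AB.1 := by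
      have : insert b AB.1 = insert c AB.1 := hbc
      rw [← this]
      exact Finset.mem_insert_self _ _
    rcases Finset.mem_insert.mp hb' with h1 | h1
    · exact h1
    · exact absurd h1 (Finset.disjoint_right.mp h.2.2 hb)
  · intro hmem
    obtain ⟨b, -, hb⟩ := Finset.mem_image.mp hmem
    obtain ⟨v, hv⟩ := Finset.card_pos.mp (h.1 ▸ ha)
    exact Finset.disjoint_left.mp h.2.2 hv (hb ▸ Finset.mem_insert_of_mem hv)

/-- If e plays B, only A is free. If e = A ∪ {b}, there are a + 1 choices of b, and then the other a
vertices of B are free. -/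
theorem card_copyPairs_filter_mem_le {a : ℕ} {e : Finset V} (he : e.card = a + 1) :
    ((copyPairs V a).filter fun AB => e ∈ copyEdges AB).card ≤
      (a + 2) * (Fintype.card V).choose a := by
  have hsub : ((copyPairs V a).filter fun AB => e ∈ copyEdges AB) ⊆
      ((Finset.univ.powersetCard a).image fun A => (A, e)) ∪
        e.biUnion fun b => (Finset.univ.powersetCard a).image fun T => (e.erase b, insert b T) := by
    rintro ⟨A, B⟩ h
    simp only [copyPairs, copyEdges, Finset.mem_filter, Finset.mem_univ, true_and,
      Finset.mem_insert, Finset.mem_image] at h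
    obtain ⟨⟨hA, hB, hAB⟩, rfl | ⟨b, hb, rfl⟩⟩ := h
    · refine Finset.mem_union_left _ (Finset.mem_image.mpr ⟨A, ?_, rfl⟩)
      exact Finset.mem_powersetCard.mpr ⟨Finset.subset_univ _, hA⟩
    · refine Finset.mem_union_right _ (Finset.mem_biUnion.mpr
        ⟨b, Finset.mem_insert_self _ _, Finset.mem_image.mpr ⟨B.erase b, ?_, ?_⟩⟩)
      · refine Finset.mem_powersetCard.mpr ⟨Finset.subset_univ _, ?_⟩
        rw [Finset.card_erase_of_mem hb, hB]; rfl
      · rw [Finset.insert_erase hb, Finset.erase_insert (Finset.disjoint_right.mp hAB hb)]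
  have hc : (Finset.univ.powersetCard a : Finset (Finset V)).card = (Fintype.card V).choose a := by
    rw [Finset.card_powersetCard, Finset.card_univ]
  refine (Finset.card_le_card hsub).trans ((Finset.card_union_le _ _).trans ?_)
  have h1 := Finset.card_image_le (s := (Finset.univ.powersetCard a : Finset (Finset V)))
    (f := fun A => (A, e))
  have h2 := Finset.card_biUnion_le_card_mul e (fun b => (Finset.univ.powersetCard a :
    Finset (Finset V)).image fun T => (e.erase b, insert b T)) ((Fintype.card V).choose a)
    fun b _ => Finset.card_image_le.trans hc.le
  rw [hc] at h1
  rw [he] at h2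
  calc _ ≤ _ := add_le_add h1 h2
    _ = _ := by ring

theorem card_copyPairs_filter_not_disjoint_le {a : ℕ} {W : Finset (Finset V)}
    (hW : ∀ e ∈ W, e.card = a + 1) :
    ((copyPairs V a).filter fun AB => ¬ Disjoint W (copyEdges AB)).card ≤
      W.card * ((a + 2) * (Fintype.card V).choose a) := by
  refine le_trans (Finset.card_le_card ?_) (Finset.card_biUnion_le_card_mul W
    (fun e => (copyPairs V a).filter fun AB => e ∈ copyEdges AB) _
    fun e he => card_copyPairs_filter_mem_le (hW e he))
  intro AB h
  simp only [Finset.mem_filter, Finset.not_disjoint_iff] at h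
  obtain ⟨h1, e, he, he'⟩ := h
  exact Finset.mem_biUnion.mpr ⟨e, he, Finset.mem_filter.mpr ⟨h1, he'⟩⟩

/-- Follows from (1 - y)(1 + 2y) ≥ 1. It is needed for exponents so large that Bernoulli's
inequality gives nothing. -/
theorem exp_neg_two_mul_le_one_sub {y : ℝ} (h0 : 0 ≤ y) (h1 : y ≤ 1 / 2) :
    Real.exp (-(2 * y)) ≤ 1 - y := by
  rw [Real.exp_neg, inv_le_iff_one_le_mul₀ (Real.exp_pos _)]
  have := Real.add_one_le_exp (2 * y)
  nlinarith

theorem dependsOn_forall_eq {ι β : Type*} (T : Finset ι) (b : β) :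
    DependsOn (fun ω : ι → β => ω ∈ {ω : ι → β | ∀ i ∈ T, ω i = b}) (T : Set ι) := by
  intro ω ω' h
  simp only [Set.mem_ofPred_eq, eq_iff_iff]
  exact forall₂_congr fun i hi => by rw [h i hi]

/-- The bad events for a random hypergraph `ω`: containing a given copy of `F_r`, and having
no edge inside a given set. -/
def badEvent (a : ℕ) : (Finset V × Finset V) ⊕ Finset V → Set (Finset V → Bool) :=
  Sum.elim (fun AB => {ω | ∀ e ∈ copyEdges AB, ω e = true})
    fun S => {ω | ∀ e ∈ S.powersetCard (a + 1), ω e = false}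

/-- The potential edges on which a bad event depends. -/
def badEdges (a : ℕ) : (Finset V × Finset V) ⊕ Finset V → Finset (Finset V) :=
  Sum.elim copyEdges fun S => S.powersetCard (a + 1)

open MeasureTheory ProbabilityTheory in
/-- The random construction of a sparse hypergraph with independent neighbourhoods and small
independence number. -/
theorem exists_indepNeighborhoods_of_le {a s : ℕ} (ha : 0 < a) {p : ℝ} (hp : 0 < p)
    (hp1 : ((a : ℝ) + 2) * p ≤ 1)
    (hcopy : ((a : ℝ) + 2) * ((Fintype.card V).choose a : ℝ) * p ^ (a + 1) ≤ 1 / 16)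
    (hindep : 8 * ((Fintype.card V).choose s : ℝ) *
      Real.exp (-(3 / 4 * (p * (s.choose (a + 1) : ℝ)))) ≤ 1) :
    ∃ E : Finset (Finset V), (∀ e ∈ E, e.card = a + 1) ∧ IndepNeighborhoods (a + 1) E ∧
      (∀ S : Finset V, S.card = s → ∃ e ∈ E, e ⊆ S) ∧
      (E.card : ℝ) ≤ 3 / 2 * p * ((Fintype.card V).choose (a + 1) : ℝ) := by
  set n := Fintype.card V with hn
  have ha' : (1 : ℝ) ≤ a := by exact_mod_cast ha
  have hp3 : p ≤ 1 / 3 := by nlinarith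
  let P : unitInterval := ⟨p, hp.le, by linarith⟩
  set ν := bernoulliMeasure true false P with hν
  have hνt : ν.real {true} = p :=
    bernoulliMeasure_real_apply_of_mem_of_notMem P (by measurability) (by simp) (by simp)
  have hνf : ν.real {false} = 1 - p :=
    bernoulliMeasure_real_apply_of_notMem_of_mem P (by measurability) (by simp) (by simp)
  -- Weights: twice the probability for a copy of F_r; for s-sets, a weight whose total is at most
  -- 1/4, so that all s-sets may count as neighbours of every event.
  set y : ℝ := 2 * p ^ (a + 2) with hy
  set z : ℝ := 1 / (4 * (n.choose s : ℝ)) with hz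
  have hy0 : 0 ≤ y := by positivity
  have hz0 : 0 ≤ z := by positivity
  have hy1 : y ≤ 1 / 2 := by
    have : p ^ (a + 2) ≤ p ^ 2 := pow_le_pow_of_le_one hp.le (by linarith) (by omega)
    nlinarith
  have hz1 : z ≤ 1 / 4 := by
    rcases Nat.eq_zero_or_pos (n.choose s) with h | h
    -- If s > n there are no s-sets, and z = 1/0 = 0.
    · rw [hz, h]; norm_num
    · have : (1 : ℝ) ≤ n.choose s := by exact_mod_cast h
      rw [hz]
      exact div_le_div_of_nonneg_left (by norm_num) (by norm_num) (by linarith)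
  have hzc : (n.choose s : ℝ) * z ≤ 1 / 4 := by
    rcases Nat.eq_zero_or_pos (n.choose s) with h | h
    · rw [h]; norm_num
    · have : (0 : ℝ) < n.choose s := by exact_mod_cast h
      rw [hz]
      refine le_of_eq ?_
      field_simp
  have hQ : (3 : ℝ) / 4 ≤ (1 - z) ^ (n.choose s) := by
    have := one_add_mul_le_pow (a := -z) (by linarith) (n.choose s)
    rw [← sub_eq_add_neg] at this
    linarith
  set J : Finset ((Finset V × Finset V) ⊕ Finset V) :=
    (copyPairs V a).disjSum (Finset.univ.powersetCard s) with hJ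
  -- Indexing by a set of potential edges serves the bad events and the single edges of the first
  -- moment alike.
  let N : Finset (Finset V) → Finset ((Finset V × Finset V) ⊕ Finset V) := fun W =>
    ((copyPairs V a).filter fun AB => ¬ Disjoint W (copyEdges AB)).disjSum
      (Finset.univ.powersetCard s)
  let x : (Finset V × Finset V) ⊕ Finset V → ℝ := Sum.elim (fun _ => y) fun _ => z
  have hx0 : ∀ i, 0 ≤ x i := by rintro (i | i) <;> assumption
  have hx1 : ∀ i, x i < 1 := by
    rintro (i | i)
    · exact lt_of_le_of_lt hy1 (by norm_num)
    · exact lt_of_le_of_lt hz1 (by norm_num)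
  have hNJ : ∀ W, N W ⊆ J := fun W =>
    Finset.disjSum_mono (Finset.filter_subset _ _) Finset.Subset.rfl
  have hprod : ∀ W : Finset (Finset V), (∀ e ∈ W, e.card = a + 1) →
      3 / 4 * (1 - y) ^ (W.card * ((a + 2) * n.choose a)) ≤ ∏ j ∈ N W, (1 - x j) := by
    intro W hW
    have h1 : ∏ j ∈ N W, (1 - x j) =
        (1 - y) ^ ((copyPairs V a).filter fun AB => ¬ Disjoint W (copyEdges AB)).card *
          (1 - z) ^ n.choose s := by
      simp [N, x, Finset.prod_disjSum, hn]
    rw [h1, mul_comm]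
    refine mul_le_mul ?_ hQ (by norm_num) (pow_nonneg (by linarith) _)
    exact pow_le_pow_of_le_one (by linarith) (by linarith)
      (card_copyPairs_filter_not_disjoint_le hW)
  -- The hypothesis `hcopy` says that the copies through one potential edge have total weight at
  -- most p/8.
  have hlin : ∀ w : ℕ, 1 - w * p / 8 ≤ (1 - y) ^ (w * ((a + 2) * n.choose a)) := by
    intro w
    have h1 := one_add_mul_le_pow (a := -y) (by linarith) (w * ((a + 2) * n.choose a))
    rw [← sub_eq_add_neg] at h1
    refine le_trans ?_ h1
    push_cast
    have h2 : (w : ℝ) * (((a : ℝ) + 2) * (n.choose a : ℝ)) * y =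
        w * p * 2 * (((a : ℝ) + 2) * (n.choose a : ℝ) * p ^ (a + 1)) := by
      rw [hy]; ring
    have h3 : (w : ℝ) * p * 2 * (((a : ℝ) + 2) * (n.choose a : ℝ) * p ^ (a + 1)) ≤
        w * p * 2 * (1 / 16) := mul_le_mul_of_nonneg_left hcopy (by positivity)
    linarith
  have hvbl : ∀ i ∈ J, DependsOn (fun ω => ω ∈ badEvent a i) (badEdges a i : Set (Finset V)) := by
    rintro (i | i) -
    · exact dependsOn_forall_eq _ _
    · exact dependsOn_forall_eq _ _
  have hdisj : ∀ W, ∀ j ∈ J, j ∉ N W → Disjoint W (badEdges a j) := by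
    rintro W (j | j) hj hjN
    · simp only [N, hJ, Finset.inl_mem_disjSum, Finset.mem_filter, not_and, not_not] at hj hjN
      exact hjN hj
    · simp only [N, hJ, Finset.inr_mem_disjSum] at hj hjN
      exact absurd hj hjN
  have hx : ∀ i ∈ J, (Measure.pi fun _ : Finset V => ν).real (badEvent a i) ≤
      x i * ∏ j ∈ N (badEdges a i), (1 - x j) := by
    rintro (AB | S) hi
    · simp only [hJ, Finset.inl_mem_disjSum] at hi
      have h1 := hprod (copyEdges AB) fun e he => card_of_mem_copyEdges hi he
      have h2 := hlin (copyEdges AB).card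
      rw [card_copyEdges ha hi] at h1 h2
      push_cast at h2
      change (Measure.pi fun _ : Finset V => ν).real {ω | ∀ e ∈ copyEdges AB, ω e = true} ≤
        y * ∏ j ∈ N (copyEdges AB), (1 - x j)
      rw [pi_real_forall_eq, hνt, card_copyEdges ha hi]
      have h3 : 1 / 2 ≤ ∏ j ∈ N (copyEdges AB), (1 - x j) := by linarith
      calc p ^ (a + 2) = y * (1 / 2) := by rw [hy]; ring
        _ ≤ _ := mul_le_mul_of_nonneg_left h3 hy0
    · simp only [hJ, Finset.inr_mem_disjSum, Finset.mem_powersetCard, Finset.subset_univ,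
        true_and] at hi
      have h1 := hprod (S.powersetCard (a + 1)) fun e he => (Finset.mem_powersetCard.mp he).2
      rw [Finset.card_powersetCard, hi] at h1
      change (Measure.pi fun _ : Finset V => ν).real
        {ω | ∀ e ∈ S.powersetCard (a + 1), ω e = false} ≤
        z * ∏ j ∈ N (S.powersetCard (a + 1)), (1 - x j)
      rw [pi_real_forall_eq, hνf, Finset.card_powersetCard, hi]
      set v := s.choose (a + 1) with hv
      have h2 : (1 - p) ^ v ≤ Real.exp (-(p * v)) := by
        have := pow_le_pow_left₀ (by linarith) (Real.one_sub_le_exp_neg p) v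
        rw [← Real.exp_nat_mul] at this
        refine this.trans (le_of_eq ?_)
        congr 1; ring
      -- A quarter of the exponent in exp(-pv) pays for the copies that meet the s-set; the other
      -- three quarters beat the number of s-sets.
      have h3 : Real.exp (-(p * v / 4)) ≤ (1 - y) ^ (v * ((a + 2) * n.choose a)) := by
        have := pow_le_pow_left₀ (Real.exp_pos _).le (exp_neg_two_mul_le_one_sub hy0 hy1)
          (v * ((a + 2) * n.choose a))
        rw [← Real.exp_nat_mul] at this
        refine le_trans (Real.exp_le_exp.mpr ?_) this
        push_cast
        have h2 : (v : ℝ) * (((a : ℝ) + 2) * (n.choose a : ℝ)) * -(2 * y) =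
          - (p * v * 4 * (((a : ℝ) + 2) * (n.choose a : ℝ) * p ^ (a + 1))) := by
          rw [hy]; ring
        have h3 : (p : ℝ) * v * 4 * (((a : ℝ) + 2) * (n.choose a : ℝ) * p ^ (a + 1)) ≤
          p * v * 4 * (1 / 16) := mul_le_mul_of_nonneg_left hcopy (by positivity)
        linarith
      have hC : (0 : ℝ) < n.choose s := by
        have : s ≤ n := by rw [← hi, hn]; exact Finset.card_le_univ S
        exact_mod_cast Nat.choose_pos this
      have h4 : Real.exp (-(3 / 4 * (p * v))) ≤ z * (3 / 4) := by
        rw [hz, one_div, ← div_eq_inv_mul, le_div_iff₀ (by positivity)]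
        linarith
      calc (1 - p) ^ v ≤ Real.exp (-(p * v)) := h2
        _ = Real.exp (-(3 / 4 * (p * v))) * Real.exp (-(p * v / 4)) := by
          rw [← Real.exp_add]; congr 1; ring
        _ ≤ z * (3 / 4) * (1 - y) ^ (v * ((a + 2) * n.choose a)) :=
          mul_le_mul h4 h3 (Real.exp_pos _).le (by positivity)
        _ = z * (3 / 4 * (1 - y) ^ (v * ((a + 2) * n.choose a))) := by ring
        _ ≤ _ := mul_le_mul_of_nonneg_left h1 hz0
  have hpos := pi_real_avoid_pos ν (fun i _ => hx0 i) (fun i _ => hx1 i)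
    (fun i _ => hNJ (badEdges a i)) hvbl (fun i _ => hdisj (badEdges a i)) hx
  -- For one potential edge the product is at least (3/4)(1 - p/8) ≥ 2/3, as p ≤ 1/3.
  have hedge : ∀ e ∈ (Finset.univ.powersetCard (a + 1) : Finset (Finset V)),
      (Measure.pi fun _ : Finset V => ν).real
        ({ω | ω e = true} ∩ {ω | ∀ j ∈ J, ω ∉ badEvent a j}) ≤
      3 / 2 * p * (Measure.pi fun _ : Finset V => ν).real {ω | ∀ j ∈ J, ω ∉ badEvent a j} := by
    intro e he
    have hset : {ω : Finset V → Bool | ω e = true} =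
        {ω | ∀ e' ∈ ({e} : Finset (Finset V)), ω e' = true} := by simp
    rw [hset]
    have h1 := prod_mul_pi_real_inter_avoid_le ν (fun i _ => hx0 i) (fun i _ => (hx1 i).le)
      (fun i _ => hNJ (badEdges a i)) hvbl (fun i _ => hdisj (badEdges a i)) hx
      (hNJ {e}) (dependsOn_forall_eq {e} true) (hdisj {e})
    have h2 := hprod {e} (by simpa using (Finset.mem_powersetCard.mp he).2)
    have h3 := hlin ({e} : Finset (Finset V)).card
    rw [Finset.card_singleton, Nat.cast_one] at h3
    rw [Finset.card_singleton] at h2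
    rw [pi_real_forall_eq ν {e} true, hνt, Finset.card_singleton, pow_one] at h1
    have h4 : 2 / 3 ≤ ∏ j ∈ N {e}, (1 - x j) := by linarith
    have h5 := mul_le_mul_of_nonneg_right h4 (measureReal_nonneg
      (μ := Measure.pi fun _ : Finset V => ν)
      (s := {ω | ∀ e' ∈ ({e} : Finset (Finset V)), ω e' = true} ∩
        {ω | ∀ j ∈ J, ω ∉ badEvent a j}))
    linarith
  obtain ⟨ω, hω, hcard⟩ := exists_mem_card_filter_le (Measure.pi fun _ : Finset V => ν)
    (Finset.univ.powersetCard (a + 1) : Finset (Finset V)) (fun e => {ω | ω e = true})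
    (c := 3 / 2 * p * (n.choose (a + 1) : ℝ)) hpos (by
      refine (Finset.sum_le_card_nsmul _ _ _ hedge).trans (le_of_eq ?_)
      rw [Finset.card_powersetCard, Finset.card_univ, nsmul_eq_mul]
      ring)
  refine ⟨(Finset.univ.powersetCard (a + 1)).filter fun e => ω e = true, ?_, ?_, ?_, ?_⟩
  · intro e he
    exact (Finset.mem_powersetCard.mp (Finset.mem_filter.mp he).1).2
  · intro A B hA hB hAB
    by_contra! hcon
    have hAB' : (A, B) ∈ copyPairs V a := by
      simp only [copyPairs, Finset.mem_filter, Finset.mem_univ, true_and]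
      exact ⟨hA, (Finset.mem_powersetCard.mp (Finset.mem_filter.mp hB).1).2, hAB⟩
    refine hω (Sum.inl (A, B)) (Finset.inl_mem_disjSum.mpr hAB') fun e he => ?_
    rcases Finset.mem_insert.mp he with rfl | he
    · exact (Finset.mem_filter.mp hB).2
    · obtain ⟨b, hb, rfl⟩ := Finset.mem_image.mp he
      exact (Finset.mem_filter.mp (hcon b hb)).2
  · intro S hS
    by_contra! hcon
    refine hω (Sum.inr S) (Finset.inr_mem_disjSum.mpr
      (Finset.mem_powersetCard.mpr ⟨Finset.subset_univ _, hS⟩)) fun e he => ?_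
    rw [Finset.mem_powersetCard] at he
    by_contra hne
    exact hcon e (Finset.mem_filter.mpr ⟨Finset.mem_powersetCard.mpr
      ⟨Finset.subset_univ _, he.2⟩, by simpa using hne⟩) he.1
  · refine le_of_eq_of_le ?_ hcard
    congr!

end RandomHypergraph

/-- The construction yields members of `edgeCounts`. -/
theorem exists_mem_edgeCounts_le {a k s : ℕ} (ha : 0 < a) (hk : 0 < k) {p : ℝ} (hp : 0 < p)
    (hp1 : ((a : ℝ) + 2) * p ≤ 1)
    (hcopy : ((a : ℝ) + 2) * ((k * s).choose a : ℝ) * p ^ (a + 1) ≤ 1 / 16)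
    (hindep : 8 * ((k * s).choose s : ℝ) *
      Real.exp (-(3 / 4 * (p * (s.choose (a + 1) : ℝ)))) ≤ 1) :
    ∃ m ∈ Hypergraph.edgeCounts (a + 1) k (Hypergraph.starF (a + 1)),
      (m : ℝ) ≤ 3 / 2 * p * ((k * s).choose (a + 1) : ℝ) := by
  obtain ⟨E, hE, hfree, hindepS, hcard⟩ := exists_indepNeighborhoods_of_le (V := Fin (k * s))
    (s := s) ha hp hp1 (by simpa using hcopy) (by simpa using hindep)
  let G : Hypergraph (Fin (k * s)) :=
    { vertexSet := Set.univ
      edgeSet := (fun e : Finset (Fin (k * s)) => (e : Set (Fin (k * s)))) '' E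
      subset_vertexSet_of_mem_edgeSet' := fun _ _ => Set.subset_univ _ }
  refine ⟨E.card, ⟨Fin (k * s), G, ⟨Set.toFinite _, ?_⟩, ?_, ?_, ?_⟩, by simpa using hcard⟩
  · rintro e ⟨e, he, rfl⟩
    rw [Set.encard_coe_eq_coe_finsetCard, hE e he]
  · rintro ⟨f, hinj, -, hf⟩
    have hinj' : Function.Injective f := fun u v h => hinj (Set.mem_univ u) (Set.mem_univ v) h
    set A := (Finset.univ : Finset (Fin (a + 1 - 1))).image fun i => f (Sum.inl i) with hA
    set B := (Finset.univ : Finset (Fin (a + 1))).image fun i => f (Sum.inr i) with hB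
    have hmemE : ∀ e : Finset (Fin (k * s)), (e : Set (Fin (k * s))) ∈ G.edgeSet → e ∈ E := by
      rintro e ⟨e', he', h⟩
      rwa [← Finset.coe_injective h]
    have hBE : B ∈ E := by
      refine hmemE B ?_
      have h := hf _ (Set.mem_insert _ _)
      rw [← Set.range_comp] at h
      rw [hB, Finset.coe_image, Finset.coe_univ, Set.image_univ]
      exact h
    obtain ⟨b, hb, hbE⟩ := hfree A B
      (by
        have hinl : Function.Injective fun i : Fin (a + 1 - 1) => f (Sum.inl i) :=
          hinj'.comp Sum.inl_injective
        rw [hA, Finset.card_image_of_injective _ hinl, Finset.card_univ, Fintype.card_fin]) hBE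
      (by
        rw [Finset.disjoint_left]
        intro v hvA hvB
        obtain ⟨i, -, rfl⟩ := Finset.mem_image.mp hvA
        obtain ⟨j, -, hj⟩ := Finset.mem_image.mp hvB
        exact absurd (hinj' hj) (by simp))
    obtain ⟨i, -, rfl⟩ := Finset.mem_image.mp hb
    refine hbE (hmemE _ ?_)
    have h := hf _ (Set.mem_insert_of_mem _ ⟨i, rfl⟩)
    rw [Set.image_insert_eq, ← Set.range_comp] at h
    rw [Finset.coe_insert, hA, Finset.coe_image, Finset.coe_univ, Set.image_univ]
    exact h
  · rw [Hypergraph.lt_chromaticNumber_iff]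
    rintro ⟨f, hf, hmono⟩
    -- By pigeonhole, k colours on ks vertices give a class with at least s vertices, which contains
    -- an edge.
    obtain ⟨c, -, hc⟩ := Finset.exists_le_card_fiber_of_mul_le_card_of_maps_to
      (s := (Finset.univ : Finset (Fin (k * s)))) (t := Finset.range k) (f := f) (n := s)
      (fun v _ => Finset.mem_range.mpr (hf v (Set.mem_univ v))) ⟨0, Finset.mem_range.mpr hk⟩
      (by simp)
    obtain ⟨S, hS, hScard⟩ := Finset.exists_subset_card_eq hc
    obtain ⟨e, he, heS⟩ := hindepS S hScard
    exact hmono e ⟨e, he, rfl⟩ ⟨c, fun v hv => (Finset.mem_filter.mp (hS (heS hv))).2⟩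
  · rw [Set.ncard_image_of_injective _ Finset.coe_injective, Set.ncard_coe_finset]

/-! ### Choice of parameters, constants and the upper bound. -/

/-- The constant `K = 16 r (r + 1) 2 ^ r r! ^ (r - 1)` for `r = t + 3`; the random construction has
independence number about `K ^ (1 / (r - 1) ^ 2) k ^ (1 / (r - 1)) (log k) ^ (r / (r - 1) ^ 2)`. -/
noncomputable def indepScale (t : ℕ) : ℝ :=
  16 * (t + 3) * (t + 4) * 2 ^ (t + 3) * ((t + 3)! : ℝ) ^ (t + 2)

theorem one_le_indepScale (t : ℕ) : 1 ≤ indepScale t := by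
  have h1 : (1 : ℝ) ≤ (t + 3)! := by exact_mod_cast Nat.factorial_pos _
  have h2 : (1 : ℝ) ≤ ((t + 3)! : ℝ) ^ (t + 2) := one_le_pow₀ h1
  have h3 : (1 : ℝ) ≤ 2 ^ (t + 3) := one_le_pow₀ (by norm_num)
  have h4 : (0 : ℝ) ≤ t := Nat.cast_nonneg t
  unfold indepScale
  have h5 : (1 : ℝ) ≤ 16 * (t + 3) := by linarith
  have h6 : (1 : ℝ) ≤ t + 4 := by linarith
  exact one_le_mul_of_one_le_of_one_le (one_le_mul_of_one_le_of_one_le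
    (one_le_mul_of_one_le_of_one_le h5 h6) h3) h2

/-- A rational z separates the power of `indepScale` from `cI` once the factorials are removed: 11/5
for t = 0, 1 for t = 1, and 9/10 afterwards. -/
theorem exists_rpow_lower_bound (t : ℕ) : ∃ z : ℝ, 0 < z ∧
    z ≤ (10 / ((t : ℝ) + 3)) ^ (1 / ((t : ℝ) + 3 / 2)) ∧
    16 * ((t : ℝ) + 3) * (t + 4) * 2 ^ (t + 3) < (3 * z) ^ ((t + 2) ^ 2) := by
  rcases Nat.lt_or_ge t 2 with ht | ht
  · interval_cases t
    · refine ⟨11 / 5, by norm_num, ?_, by norm_num⟩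
      have h : ((11 / 5 : ℝ) ^ (3 : ℕ)) ^ (1 / 3 : ℝ) ≤ ((10 / 3 : ℝ) ^ (2 : ℕ)) ^ (1 / 3 : ℝ) :=
        Real.rpow_le_rpow (by norm_num) (by norm_num) (by norm_num)
      rw [← Real.rpow_natCast, ← Real.rpow_natCast, ← Real.rpow_mul (by norm_num),
        ← Real.rpow_mul (by norm_num)] at h
      norm_num at h ⊢
      exact h
    · refine ⟨1, by norm_num, ?_, by norm_num⟩
      exact Real.one_le_rpow (by norm_num) (by norm_num)
  · refine ⟨9 / 10, by norm_num, ?_, ?_⟩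
    · have ht0 : (0 : ℝ) ≤ t := Nat.cast_nonneg t
      have hu : (0 : ℝ) < (t : ℝ) + 3 / 2 := by positivity
      have h1 : ((9 / 10 : ℝ)) ^ ((t : ℝ) + 3 / 2) ≤ 10 / ((t : ℝ) + 3) := by
        calc ((9 / 10 : ℝ)) ^ ((t : ℝ) + 3 / 2) ≤ (9 / 10 : ℝ) ^ ((t + 1 : ℕ) : ℝ) := by
              refine Real.rpow_le_rpow_of_exponent_ge (by norm_num) (by norm_num) ?_
              push_cast; linarith
          _ = (9 / 10 : ℝ) ^ (t + 1) := Real.rpow_natCast _ _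
          _ ≤ 10 / ((t : ℝ) + 3) := by
              have h := one_add_mul_le_pow (a := (1 / 9 : ℝ)) (by norm_num) (t + 1)
              have h2 : (9 / 10 : ℝ) ^ (t + 1) * (1 + 1 / 9) ^ (t + 1) = 1 := by
                rw [← mul_pow]; norm_num
              rw [le_div_iff₀ (by positivity)]
              have h3 : (t : ℝ) + 3 ≤ 10 * (1 + 1 / 9) ^ (t + 1) := by
                push_cast at h; linarith
              have h4 : (0 : ℝ) < (9 / 10 : ℝ) ^ (t + 1) := by positivity
              nlinarith
      have h2 := Real.rpow_le_rpow (by positivity) h1 (by positivity : 0 ≤ 1 / ((t : ℝ) + 3 / 2))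
      rwa [← Real.rpow_mul (by norm_num), mul_one_div_cancel hu.ne', Real.rpow_one] at h2
    -- The base 50 works because 50 ≤ (27/10)^4 and 4(t+2) ≤ (t+2)².
    · have h1 : ∀ t : ℕ, 2 ≤ t → 16 * (t + 3) * (t + 4) * 2 ^ (t + 3) < 50 ^ (t + 2) := by
        intro t ht
        induction t, ht using Nat.le_induction with
        | base => norm_num
        | succ n hn ih =>
          have h2 : 16 * (n + 1 + 3) * (n + 1 + 4) * 2 ^ (n + 1 + 3) ≤
              4 * (16 * (n + 3) * (n + 4) * 2 ^ (n + 3)) := by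
            rw [show n + 1 + 3 = (n + 3) + 1 by ring, pow_succ]
            have : (n + 3 + 1) * (n + 1 + 4) ≤ 2 * ((n + 3) * (n + 4)) := by nlinarith
            calc _ = 32 * 2 ^ (n + 3) * ((n + 3 + 1) * (n + 1 + 4)) := by ring
              _ ≤ 32 * 2 ^ (n + 3) * (2 * ((n + 3) * (n + 4))) := Nat.mul_le_mul_left _ this
              _ = _ := by ring
          rw [show n + 1 + 2 = (n + 2) + 1 by ring, pow_succ 50 (n + 2)]
          omega
      calc 16 * ((t : ℝ) + 3) * (t + 4) * 2 ^ (t + 3) < 50 ^ (t + 2) := by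
            exact_mod_cast h1 t ht
        _ ≤ ((3 * (9 / 10)) ^ 4) ^ (t + 2) := pow_le_pow_left₀ (by norm_num) (by norm_num) _
        _ = (3 * (9 / 10)) ^ (4 * (t + 2)) := (pow_mul _ _ _).symm
        _ ≤ _ := pow_le_pow_right₀ (by norm_num) (by nlinarith)

/-- The constant of the random construction lies below the one of the theorem. -/
theorem indepScale_rpow_lt_cI (t : ℕ) :
    10 / 3 * indepScale t ^ (1 / ((t : ℝ) + 2) ^ 2) < cI (t + 3) := by
  obtain ⟨z, hz0, hz, hM⟩ := exists_rpow_lower_bound t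
  have ht0 : (0 : ℝ) ≤ t := Nat.cast_nonneg t
  set f : ℝ := ((t + 3)! : ℝ) with hf
  have hf1 : 1 ≤ f := by rw [hf]; exact_mod_cast Nat.factorial_pos _
  set M : ℝ := 16 * ((t : ℝ) + 3) * (t + 4) * 2 ^ (t + 3) with hMdef
  have hM0 : 0 < M := by positivity
  have hsq : (((t + 2) ^ 2 : ℕ) : ℝ) = ((t : ℝ) + 2) ^ 2 := by push_cast; ring
  have h1 : M ^ (1 / ((t : ℝ) + 2) ^ 2) < 3 * z := by
    have := Real.rpow_lt_rpow hM0.le hM (by positivity : 0 < 1 / ((t : ℝ) + 2) ^ 2)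
    rwa [← Real.rpow_natCast (3 * z), hsq, ← Real.rpow_mul (by positivity),
      mul_one_div_cancel (by positivity), Real.rpow_one] at this
  have h2 : indepScale t ^ (1 / ((t : ℝ) + 2) ^ 2) =
      M ^ (1 / ((t : ℝ) + 2) ^ 2) * f ^ (1 / ((t : ℝ) + 2)) := by
    have : indepScale t = M * f ^ (t + 2) := rfl
    rw [this, Real.mul_rpow hM0.le (by positivity), ← Real.rpow_natCast f,
      ← Real.rpow_mul (by positivity)]
    congr 2
    push_cast
    field_simp
  have h3 : f ^ (1 / ((t : ℝ) + 2)) ≤ f ^ (1 / ((t : ℝ) + 3 / 2)) := by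
    refine Real.rpow_le_rpow_of_exponent_le hf1 ?_
    exact one_div_le_one_div_of_le (by positivity) (by linarith)
  have h4 : 10 * ((10 / ((t : ℝ) + 3)) ^ (1 / ((t : ℝ) + 3 / 2)) *
      f ^ (1 / ((t : ℝ) + 3 / 2))) ≤ cI (t + 3) := by
    have hr : (((t + 3 : ℕ) : ℝ)) = (t : ℝ) + 3 := by push_cast; ring
    -- A crude bound for the inner root in `cI` suffices: its radicand is at least r^(-r).
    have hX : 1 / ((t : ℝ) + 3) ≤
        (50 * f * (((t : ℝ) + 3) + 1) / ((t + 2)! : ℝ) ^ 2) ^ (1 / ((t : ℝ) + 3)) := by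
      have h5 : (1 / ((t : ℝ) + 3)) ^ (t + 3) ≤
          50 * f * (((t : ℝ) + 3) + 1) / ((t + 2)! : ℝ) ^ 2 := by
        have h6 : f = ((t : ℝ) + 3) * ((t + 2)! : ℝ) := by
          rw [hf, Nat.factorial_succ]; push_cast; ring
        have h7 : ((t + 2)! : ℝ) ≤ ((t : ℝ) + 3) ^ (t + 3) := by
          have : (t + 2)! ≤ (t + 3) ^ (t + 3) :=
            (Nat.factorial_le (by omega)).trans (Nat.factorial_le_pow (t + 3))
          exact_mod_cast this
        have h8 : (0 : ℝ) < (t + 2)! := by exact_mod_cast Nat.factorial_pos _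
        rw [div_pow, one_pow, div_le_div_iff₀ (by positivity) (by positivity), h6]
        have h9 : (1 : ℝ) ≤ 50 * (((t : ℝ) + 3) * ((t : ℝ) + 3 + 1)) := by nlinarith
        calc 1 * ((t + 2)! : ℝ) ^ 2 = 1 * ((t + 2)! * ((t + 2)! : ℝ)) := by ring
          _ ≤ 50 * (((t : ℝ) + 3) * ((t : ℝ) + 3 + 1)) *
              ((t + 2)! * ((t : ℝ) + 3) ^ (t + 3)) := by gcongr
          _ = _ := by ring
      have := Real.rpow_le_rpow (by positivity) h5 (by positivity : 0 ≤ 1 / ((t : ℝ) + 3))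
      rwa [← Real.rpow_natCast, ← Real.rpow_mul (by positivity), hr,
        mul_one_div_cancel (by positivity), Real.rpow_one] at this
    have hY : 10 * 10 ^ (1 / ((t : ℝ) + 3 / 2)) ≤
        (10 * (((t : ℝ) + 3) - 1) / (((t : ℝ) + 3) - 3 / 2)) ^
          ((((t : ℝ) + 3) - 1 / 2) / (((t : ℝ) + 3) - 3 / 2)) := by
      have h5 : (((t : ℝ) + 3) - 1 / 2) / (((t : ℝ) + 3) - 3 / 2) =
          1 + 1 / ((t : ℝ) + 3 / 2) := by
        rw [show ((t : ℝ) + 3) - 3 / 2 = (t : ℝ) + 3 / 2 by ring]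
        field_simp; ring
      rw [h5]
      calc 10 * (10 : ℝ) ^ (1 / ((t : ℝ) + 3 / 2)) = 10 ^ (1 + 1 / ((t : ℝ) + 3 / 2)) := by
            rw [Real.rpow_add (by norm_num), Real.rpow_one]
        _ ≤ _ := by
            refine Real.rpow_le_rpow (by norm_num) ?_ (by positivity)
            rw [le_div_iff₀ (by linarith)]
            linarith
    have hcI : cI (t + 3) =
        (f * (50 * f * (((t : ℝ) + 3) + 1) / ((t + 2)! : ℝ) ^ 2) ^ (1 / ((t : ℝ) + 3))) ^
          (1 / ((t : ℝ) + 3 / 2)) *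
        (10 * (((t : ℝ) + 3) - 1) / (((t : ℝ) + 3) - 3 / 2)) ^
          ((((t : ℝ) + 3) - 1 / 2) / (((t : ℝ) + 3) - 3 / 2)) := by
      rw [cI, hr, show t + 3 - 1 = t + 2 from rfl,
        show 1 / ((t : ℝ) + 3 - 3 / 2) = 1 / ((t : ℝ) + 3 / 2) by ring]
    rw [hcI]
    calc _ = (f * (1 / ((t : ℝ) + 3))) ^ (1 / ((t : ℝ) + 3 / 2)) *
          (10 * 10 ^ (1 / ((t : ℝ) + 3 / 2))) := by
          rw [Real.mul_rpow (by positivity) (by positivity),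
            div_eq_mul_one_div 10 ((t : ℝ) + 3), Real.mul_rpow (by positivity) (by positivity)]
          ring
      _ ≤ _ := by
          refine mul_le_mul ?_ hY (by positivity) (by positivity)
          exact Real.rpow_le_rpow (by positivity)
            (mul_le_mul_of_nonneg_left hX (by positivity)) (by positivity)
  calc 10 / 3 * indepScale t ^ (1 / ((t : ℝ) + 2) ^ 2)
      = 10 / 3 * (M ^ (1 / ((t : ℝ) + 2) ^ 2) * f ^ (1 / ((t : ℝ) + 2))) := by rw [h2]
    _ < 10 / 3 * (3 * z * f ^ (1 / ((t : ℝ) + 2))) := by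
        have : 0 < f ^ (1 / ((t : ℝ) + 2)) := by positivity
        gcongr
    _ = 10 * (z * f ^ (1 / ((t : ℝ) + 2))) := by ring
    _ ≤ 10 * ((10 / ((t : ℝ) + 3)) ^ (1 / ((t : ℝ) + 3 / 2)) *
      f ^ (1 / ((t : ℝ) + 3 / 2))) := by gcongr
    _ ≤ _ := h4

/-- The numerical conditions of the random construction, in terms of `L = log k`. -/
theorem exists_mem_edgeCounts_le_of_large {t k s : ℕ} (hk : 0 < k) {L : ℝ}
    (hL : L = Real.log k) (hL12 : 12 ≤ L)
    (hkL : 2 * ((t + 3)! : ℝ) * (t + 4) * L ≤ k) (hsk : (k : ℝ) ≤ (s : ℝ) ^ (t + 2))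
    (hs : 9 * ((t : ℝ) + 2) * (t + 3) ≤ s)
    (hscale : indepScale t * k ^ (t + 2) * L ^ (t + 3) ≤ (s : ℝ) ^ ((t + 2) ^ 2)) :
    ∃ m ∈ Hypergraph.edgeCounts (t + 3) k (Hypergraph.starF (t + 3)),
      (m : ℝ) ≤ 3 * L * k ^ (t + 3) * s := by
  have ht0 : (0 : ℝ) ≤ t := Nat.cast_nonneg t
  have hk0 : (0 : ℝ) < k := by exact_mod_cast hk
  have hs0 : (0 : ℝ) < s := lt_of_lt_of_le (by positivity) hs
  set f : ℝ := ((t + 3)! : ℝ) with hf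
  have hf0 : 0 < f := by rw [hf]; exact_mod_cast Nat.factorial_pos _
  have hL0 : 0 < L := by linarith
  -- An s-set is expected to contain about 2sL edges, against log C(ks, s) ≤ sL + s.
  set p : ℝ := 2 * f * L / (s : ℝ) ^ (t + 2) with hp
  have hp0 : 0 < p := by positivity
  have hchoose : ∀ j : ℕ, ((k * s).choose j : ℝ) ≤ (k * s : ℝ) ^ j / (j ! : ℝ) := by
    intro j
    have := Nat.choose_le_pow_div (α := ℝ) j (k * s)
    push_cast at this
    exact this
  have hp1 : (((t + 2 : ℕ) : ℝ) + 2) * p ≤ 1 := by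
    rw [hp, mul_div_assoc', div_le_one (by positivity)]
    push_cast
    calc ((t : ℝ) + 2 + 2) * (2 * f * L) = 2 * f * (t + 4) * L := by ring
      _ ≤ _ := hkL.trans hsk
  -- The net power of 1/s is r(r-1) - (r-1) = (r-1)², and `indepScale` is exactly the constant that
  -- yields 1/16.
  have hcopy : (((t + 2 : ℕ) : ℝ) + 2) * ((k * s).choose (t + 2) : ℝ) * p ^ (t + 2 + 1) ≤
      1 / 16 := by
    have hg : f = ((t : ℝ) + 3) * ((t + 2)! : ℝ) := by
      rw [hf, Nat.factorial_succ]; push_cast; ring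
    have hg0 : (0 : ℝ) < ((t + 2)! : ℝ) := by exact_mod_cast Nat.factorial_pos _
    have hspow : ((s : ℝ) ^ (t + 2)) ^ (t + 3) = (s : ℝ) ^ (t + 2) * (s : ℝ) ^ ((t + 2) ^ 2) := by
      rw [← pow_mul, ← pow_add]; congr 1; ring
    have hK0 : 0 < indepScale t := lt_of_lt_of_le one_pos (one_le_indepScale t)
    calc (((t + 2 : ℕ) : ℝ) + 2) * ((k * s).choose (t + 2) : ℝ) * p ^ (t + 2 + 1)
        ≤ (((t + 2 : ℕ) : ℝ) + 2) * ((k * s : ℝ) ^ (t + 2) / ((t + 2)! : ℝ)) * p ^ (t + 2 + 1) := by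
          gcongr
          exact hchoose (t + 2)
      _ = ((t : ℝ) + 4) * (2 * f) ^ (t + 3) / ((t + 2)! : ℝ) *
          (k ^ (t + 2) * L ^ (t + 3) / (s : ℝ) ^ ((t + 2) ^ 2)) := by
          rw [hp, div_pow, show t + 2 + 1 = t + 3 from rfl, hspow, mul_pow (k : ℝ),
            mul_pow (2 * f) L]
          push_cast
          field_simp
          ring
      _ ≤ ((t : ℝ) + 4) * (2 * f) ^ (t + 3) / ((t + 2)! : ℝ) * (1 / indepScale t) := by
          refine mul_le_mul_of_nonneg_left ?_ (by positivity)
          rw [div_le_div_iff₀ (by positivity) hK0]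
          linarith
      _ = 1 / 16 := by
          have : indepScale t = 16 * (t + 3) * (t + 4) * 2 ^ (t + 3) * f ^ (t + 2) := rfl
          rw [this, mul_pow, pow_succ f (t + 2)]
          nth_rewrite 2 [hg]
          field_simp
  have hindep : 8 * ((k * s).choose s : ℝ) *
      Real.exp (-(3 / 4 * (p * (s.choose (t + 2 + 1) : ℝ)))) ≤ 1 := by
    have h1 : ((k * s).choose s : ℝ) ≤ Real.exp (s * L + s) := by
      have h2 := Real.pow_div_factorial_le_exp (s : ℝ) hs0.le s
      have h3 : (k : ℝ) ^ s = Real.exp (s * L) := by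
        rw [Real.exp_nat_mul, hL, Real.exp_log hk0]
      calc ((k * s).choose s : ℝ) ≤ (k * s : ℝ) ^ s / (s ! : ℝ) := hchoose s
        _ = Real.exp (s * L) * ((s : ℝ) ^ s / (s ! : ℝ)) := by rw [mul_pow, h3]; ring
        _ ≤ Real.exp (s * L) * Real.exp s := mul_le_mul_of_nonneg_left h2 (Real.exp_pos _).le
        _ = _ := (Real.exp_add _ _).symm
    have h8 : (8 : ℝ) ≤ Real.exp 3 := by
      have h2 : (2 : ℝ) ≤ Real.exp 1 := by
        have := Real.add_one_le_exp (1 : ℝ)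
        linarith
      calc (8 : ℝ) = 2 ^ 3 := by norm_num
        _ ≤ Real.exp 1 ^ 3 := pow_le_pow_left₀ (by norm_num) h2 3
        _ = Real.exp 3 := by rw [← Real.exp_nat_mul]; norm_num
    have hps : 16 / 9 * (L * s) ≤ p * (s.choose (t + 2 + 1) : ℝ) := by
      have hts : t + 2 ≤ s := by
        have : ((t + 2 : ℕ) : ℝ) ≤ s := by push_cast; nlinarith
        exact_mod_cast this
      have hdesc : ((s : ℝ) - (t + 2)) ^ (t + 3) ≤ f * (s.choose (t + 2 + 1) : ℝ) := by
        have h2 := Nat.pow_sub_le_descFactorial s (t + 3)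
        rw [Nat.descFactorial_eq_factorial_mul_choose,
          show s + 1 - (t + 3) = s - (t + 2) by omega] at h2
        have h3 : (((s - (t + 2)) ^ (t + 3) : ℕ) : ℝ) ≤ ((t + 3)! * s.choose (t + 3) : ℕ) := by
          exact_mod_cast h2
        push_cast [Nat.cast_sub hts] at h3
        exact h3
      have hB : 8 / 9 * (s : ℝ) ^ (t + 3) ≤ ((s : ℝ) - (t + 2)) ^ (t + 3) := by
        have h2 : ((t : ℝ) + 2) / s ≤ 1 := by rw [div_le_one hs0]; nlinarith
        have h3 := one_add_mul_le_pow (a := -(((t : ℝ) + 2) / s)) (by linarith) (t + 3)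
        have h4 : ((t + 3 : ℕ) : ℝ) * (((t : ℝ) + 2) / s) ≤ 1 / 9 := by
          rw [mul_div_assoc', div_le_iff₀ hs0]
          push_cast
          linarith
        have h5 : (s : ℝ) - (t + 2) = (1 + -(((t : ℝ) + 2) / s)) * s := by
          field_simp
          ring
        rw [h5, mul_pow]
        refine mul_le_mul_of_nonneg_right ?_ (by positivity)
        linarith
      calc 16 / 9 * (L * s) = 2 * L / (s : ℝ) ^ (t + 2) * (8 / 9 * (s : ℝ) ^ (t + 3)) := by
            rw [pow_succ (s : ℝ) (t + 2)]
            field_simp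
            norm_num
        _ ≤ 2 * L / (s : ℝ) ^ (t + 2) * (f * (s.choose (t + 2 + 1) : ℝ)) :=
            mul_le_mul_of_nonneg_left (hB.trans hdesc) (by positivity)
        _ = _ := by rw [hp]; ring
    calc 8 * ((k * s).choose s : ℝ) * Real.exp (-(3 / 4 * (p * (s.choose (t + 2 + 1) : ℝ))))
        ≤ Real.exp 3 * Real.exp (s * L + s) *
          Real.exp (-(3 / 4 * (p * (s.choose (t + 2 + 1) : ℝ)))) := by gcongr
      _ = Real.exp (3 + (s * L + s) + -(3 / 4 * (p * (s.choose (t + 2 + 1) : ℝ)))) := by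
          rw [Real.exp_add (3 + (s * L + s)), Real.exp_add 3]
      _ ≤ Real.exp 0 := by
          -- The exponent is at most 3 + s - sL/3, nonpositive for L ≥ 12.
          refine Real.exp_le_exp.mpr ?_
          nlinarith
      _ = 1 := Real.exp_zero
  obtain ⟨m, hm, hmle⟩ := exists_mem_edgeCounts_le (a := t + 2) (k := k) (s := s) (p := p)
    (by omega) hk hp0 hp1 hcopy hindep
  refine ⟨m, hm, hmle.trans ?_⟩
  calc 3 / 2 * p * ((k * s).choose (t + 2 + 1) : ℝ)
      ≤ 3 / 2 * p * ((k * s : ℝ) ^ (t + 3) / f) :=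
        mul_le_mul_of_nonneg_left (hchoose (t + 3)) (by positivity)
    _ = _ := by
        rw [hp, mul_pow, pow_succ (s : ℝ) (t + 2)]
        field_simp

/-- The copy condition dictates s = ⌈κyℓ⌉. As y ≥ 9, rounding costs at most a factor 10/9, so the
constant is 3 · (10/9) κ = (10/3) κ, which lies below `cI`. -/
theorem eventually_exists_mem_edgeCounts_lt (r : ℕ) (hr : 3 ≤ r) :
    ∀ᶠ k : ℕ in atTop, ∃ m ∈ Hypergraph.edgeCounts r k (Hypergraph.starF r),
      (m : ℝ) < cI r * (k : ℝ) ^ ((r : ℝ) + 1 / ((r : ℝ) - 1)) *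
        Real.log k ^ (1 + (r : ℝ) / ((r : ℝ) - 1) ^ 2) := by
  obtain ⟨t, rfl⟩ : ∃ t, r = t + 3 := ⟨r - 3, by omega⟩
  have ht0 : (0 : ℝ) ≤ t := Nat.cast_nonneg t
  have hlog : ∀ᶠ k : ℕ in atTop, (12 : ℝ) ≤ Real.log k :=
    (Real.tendsto_log_atTop.comp tendsto_natCast_atTop_atTop).eventually_ge_atTop 12
  have hpow : ∀ᶠ k : ℕ in atTop,
      9 * ((t : ℝ) + 2) * (t + 3) ≤ (k : ℝ) ^ (1 / ((t : ℝ) + 2)) :=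
    ((tendsto_rpow_atTop (by positivity)).comp tendsto_natCast_atTop_atTop).eventually_ge_atTop _
  have hf0 : (0 : ℝ) < ((t + 3)! : ℝ) := by exact_mod_cast Nat.factorial_pos _
  have hlittle : ∀ᶠ k : ℕ in atTop, 2 * ((t + 3)! : ℝ) * (t + 4) * Real.log k ≤ k := by
    have h := tendsto_natCast_atTop_atTop.eventually (Real.isLittleO_log_id_atTop.def
      (c := 1 / (2 * ((t + 3)! : ℝ) * (t + 4))) (by positivity))
    filter_upwards [h] with k hk
    simp only [id, Real.norm_eq_abs, Nat.abs_cast] at hk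
    have := (le_abs_self _).trans hk
    rw [one_div, ← div_eq_inv_mul, le_div_iff₀ (by positivity)] at this
    linarith
  filter_upwards [hlog, hpow, hlittle, eventually_gt_atTop 0] with k hL hy hkL hk
  have hk0 : (0 : ℝ) < k := by exact_mod_cast hk
  set L : ℝ := Real.log k with hLdef
  set y : ℝ := (k : ℝ) ^ (1 / ((t : ℝ) + 2)) with hydef
  have hypow : y ^ (t + 2) = k := by
    rw [hydef, ← Real.rpow_natCast, ← Real.rpow_mul hk0.le]
    push_cast
    rw [one_div, inv_mul_cancel₀ (by positivity), Real.rpow_one]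
  have hK1 := one_le_indepScale t
  have hL0 : 0 < L := by linarith
  set κ : ℝ := indepScale t ^ (1 / ((t : ℝ) + 2) ^ 2) with hκ
  set ℓ : ℝ := L ^ (((t : ℝ) + 3) / ((t : ℝ) + 2) ^ 2) with hℓ
  have hκ1 : 1 ≤ κ := Real.one_le_rpow hK1 (by positivity)
  have hℓ1 : 1 ≤ ℓ := Real.one_le_rpow (by linarith) (by positivity)
  have hy0 : 0 < y := by positivity
  have hy9 : 9 ≤ y := by nlinarith
  have hyσ : y ≤ κ * y * ℓ := by
    have h1 : y ≤ κ * y := le_mul_of_one_le_left hy0.le hκ1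
    exact h1.trans (le_mul_of_one_le_right (by positivity) hℓ1)
  have hsq : (((t + 2) ^ 2 : ℕ) : ℝ) = ((t : ℝ) + 2) ^ 2 := by push_cast; ring
  have hκpow : κ ^ ((t + 2) ^ 2) = indepScale t := by
    rw [hκ, ← Real.rpow_natCast, ← Real.rpow_mul (by linarith), hsq, one_div,
      inv_mul_cancel₀ (by positivity), Real.rpow_one]
  have hℓpow : ℓ ^ ((t + 2) ^ 2) = L ^ (t + 3) := by
    rw [hℓ, ← Real.rpow_natCast, ← Real.rpow_mul hL0.le, hsq,
      div_mul_cancel₀ _ (by positivity), ← Real.rpow_natCast]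
    push_cast; rfl
  have hypow' : y ^ ((t + 2) ^ 2) = (k : ℝ) ^ (t + 2) := by
    rw [sq, pow_mul, hypow]
  set s : ℕ := ⌈κ * y * ℓ⌉₊ with hs
  have hσs : κ * y * ℓ ≤ s := Nat.le_ceil _
  have hsσ : (s : ℝ) ≤ 10 / 9 * (κ * y * ℓ) := by
    have : (s : ℝ) < κ * y * ℓ + 1 := Nat.ceil_lt_add_one (by positivity)
    linarith
  obtain ⟨m, hm, hmle⟩ := exists_mem_edgeCounts_le_of_large (t := t) (s := s) hk hLdef hL hkL
    (by rw [← hypow]; exact pow_le_pow_left₀ hy0.le (hyσ.trans hσs) _)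
    (hy.trans (hyσ.trans hσs))
    (by
      refine le_trans (le_of_eq ?_) (pow_le_pow_left₀ (by positivity) hσs _)
      rw [mul_pow, mul_pow, hκpow, hypow', hℓpow])
  refine ⟨m, hm, lt_of_le_of_lt hmle ?_⟩
  have hexp : (k : ℝ) ^ (((t + 3 : ℕ) : ℝ) + 1 / (((t + 3 : ℕ) : ℝ) - 1)) =
      (k : ℝ) ^ (t + 3) * y := by
    rw [Real.rpow_add hk0, Real.rpow_natCast, hydef]
    push_cast
    ring_nf
  have hexpL : L ^ (1 + ((t + 3 : ℕ) : ℝ) / (((t + 3 : ℕ) : ℝ) - 1) ^ 2) = L * ℓ := by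
    rw [Real.rpow_add hL0, Real.rpow_one, hℓ]
    push_cast
    ring_nf
  rw [hexp, hexpL]
  calc 3 * L * (k : ℝ) ^ (t + 3) * s ≤ 3 * L * (k : ℝ) ^ (t + 3) * (10 / 9 * (κ * y * ℓ)) := by
        gcongr
    _ = 10 / 3 * κ * (k ^ (t + 3) * y * (L * ℓ)) := by ring
    _ < cI (t + 3) * (k ^ (t + 3) * y * (L * ℓ)) :=
        mul_lt_mul_of_pos_right (indepScale_rpow_lt_cI t) (by positivity)
    _ = _ := by ring

theorem theorem4 (r : ℕ) (hr : 3 ≤ r) :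
    ∀ᶠ k : ℕ in atTop,
      IsLeast (Hypergraph.edgeCounts r k (Hypergraph.starF r))
        (Hypergraph.minEdges r k (Hypergraph.starF r)) ∧
      bI r * (k : ℝ) ^ ((r : ℝ) + 1 / ((r : ℝ) - 1))
        < (Hypergraph.minEdges r k (Hypergraph.starF r) : ℝ) ∧
      (Hypergraph.minEdges r k (Hypergraph.starF r) : ℝ)
        < cI r * (k : ℝ) ^ ((r : ℝ) + 1 / ((r : ℝ) - 1)) *
          Real.log k ^ (1 + (r : ℝ) / ((r : ℝ) - 1) ^ 2) := by
  filter_upwards [eventually_bI_mul_lt_of_mem_edgeCounts r hr,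
    eventually_exists_mem_edgeCounts_lt r hr] with k hlower ⟨m, hm, hupper⟩
  -- The infimum of an empty set of naturals would be 0; the construction supplies a member, so the
  -- minimum is attained.
  have hmem : Hypergraph.minEdges r k (Hypergraph.starF r) ∈
      Hypergraph.edgeCounts r k (Hypergraph.starF r) := Nat.sInf_mem ⟨m, hm⟩
  refine ⟨⟨hmem, fun n hn => Nat.sInf_le hn⟩, hlower _ hmem, lt_of_le_of_lt ?_ hupper⟩
  exact_mod_cast Nat.sInf_le hm
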